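/- A real mixed Hodge structure is a finite-dimensional real vector space $H$ together with a finite increasing filtration $W_\bullet$ of $H$ (the weight filtration, indexed by $\mathbf{Z}$) and a finite decreasing filtration $F^\bullet$ of $H_{\mathbf{C}}=\mathbf{C}\otimes_{\mathbf{R}}H$ (the Hodge filtration, indexed by $\mathbf{Z}$) such that for every $n\in\mathbf{Z}$ the filtrations induced by $F^\bullet$ and by its complex conjugate $\overline{F}^\bullet$ on $\mathrm{Gr}^W_n H_{\mathbf{C}}=(W_n)_{\mathbf{C}}/(W_{n-1})_{\mathbf{C}}$ are $n$-opposed, i.e. $\mathrm{Gr}^W_nH_{\mathbf{C}}=F^p\,\mathrm{Gr}^W_nH_{\mathbf{C}}\oplus\overline{F}^q\,\mathrm{Gr}^W_nH_{\mathbf{C}}$ whenever $p+q=n+1$. A morphism of real mixed Hodge structures is an $\mathbf{R}$-linear map compatible with $W_\bullet$ whose complexification is compatible with $F^\bullet$ (such a map is automatically strictly compatible with $W_\bullet$, $F^\bullet$ and $\overline{F}^\bullet$). These objects and morphisms form an abelian category $\mathrm{MHS}$. Proposition. For any two real mixed Hodge structures $A$ and $B$ and every integer $p>1$, the extension group in the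 abelian category $\mathrm{MHS}$ vanishes: $\mathrm{Ext}^p_{\mathrm{MHS}}(B,A)=0$. -/

import Mathlib

open CategoryTheory CategoryTheory.Limits
open scoped TensorProduct

universe u

namespace MHS

section Filtrations

variable {V : Type*} [AddCommGroup V] [Module ℂ V]

/-- The filtration induced by `F` on `Gr^W_n V = W n / W (n - 1)`; its `p`-th step is
`((F p ∩ W n) + W (n - 1)) / W (n - 1)`. -/
def grFil (W F : ℤ → Submodule ℂ V) (n p : ℤ) :
    Submodule ℂ (↥(W n) ⧸ (W (n - 1)).submoduleOf (W n)) :=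
  ((F p).submoduleOf (W n)).map ((W (n - 1)).submoduleOf (W n)).mkQ

/-- For every `n`, the filtrations induced by `F` and `G` on `Gr^W_n V` are `n`-opposed:
`Gr^W_n V` is the direct sum of `F^p` and `G^q` whenever `p + q = n + 1`. -/
def Opposed (W F G : ℤ → Submodule ℂ V) : Prop :=
  ∀ n p q : ℤ, p + q = n + 1 → IsCompl (grFil W F n p) (grFil W G n q)

end Filtrations

section Complexification

variable (H : Type*) [AddCommGroup H] [Module ℝ H]

/-- Complex conjugation of `ℂ ⊗ H` with respect to its real form `H`. -/
noncomputable def conj : (ℂ ⊗[ℝ] H) →ₛₗ[starRingEnd ℂ] (ℂ ⊗[ℝ] H) where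
  toFun := TensorProduct.map Complex.conjAe.toLinearMap LinearMap.id
  map_add' := map_add _
  map_smul' c x := by
    induction x with
    | zero => simp
    | tmul a h => simp [TensorProduct.smul_tmul']
    | add x y hx hy => simp only [smul_add, map_add, hx, hy]

end Complexification

end MHS

open MHS in
/-- A real mixed Hodge structure: a finite-dimensional real vector space `H` with a finite
increasing weight filtration `W` and a finite decreasing Hodge filtration `F` on `ℂ ⊗ H`
such that, for every `n`, `F` and its complex conjugate induce `n`-opposed filtrations on
`Gr^W_n (ℂ ⊗ H)`. -/
structure RealMHS where
  /-- the underlying real vector space -/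
  carrier : Type u
  [addCommGroup : AddCommGroup carrier]
  [module : Module ℝ carrier]
  [finite : FiniteDimensional ℝ carrier]
  /-- the weight filtration -/
  W : ℤ → Submodule ℝ carrier
  /-- the Hodge filtration -/
  F : ℤ → Submodule ℂ (ℂ ⊗[ℝ] carrier)
  W_mono : Monotone W
  W_bot : ∃ n, W n = ⊥
  W_top : ∃ n, W n = ⊤
  F_anti : Antitone F
  F_bot : ∃ p, F p = ⊥
  F_top : ∃ p, F p = ⊤
  opposed : Opposed (fun n => (W n).baseChange ℂ) F (fun q => (F q).map (conj carrier))

namespace RealMHS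

attribute [instance] addCommGroup module finite

/-- A morphism of real mixed Hodge structures: a real linear map compatible with the weight
filtration, whose complexification is compatible with the Hodge filtration (hence with the
conjugate filtration). Such a map is automatically strictly compatible with the three
filtrations: see `Hom.strict_W`, `Hom.strict_F` and `Hom.strict_conjF`. -/
@[ext]
structure Hom (A B : RealMHS.{u}) where
  /-- the underlying real linear map -/
  toLin : A.carrier →ₗ[ℝ] B.carrier
  map_W : ∀ n, ∀ x ∈ A.W n, toLin x ∈ B.W n
  map_F : ∀ p, ∀ x ∈ A.F p, toLin.baseChange ℂ x ∈ B.F p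

instance : Category RealMHS.{u} where
  Hom := Hom
  id A := ⟨LinearMap.id, fun _ _ h => h, fun _ _ h => by simpa using h⟩
  comp f g := ⟨g.toLin ∘ₗ f.toLin, fun n x h => g.map_W n _ (f.map_W n x h),
    fun p x h => by
      rw [LinearMap.baseChange_comp]
      exact g.map_F p _ (f.map_F p x h)⟩

variable {A B C : RealMHS.{u}}

/-- The real linear map underlying a morphism of real mixed Hodge structures. -/
def lin (f : A ⟶ B) : A.carrier →ₗ[ℝ] B.carrier := Hom.toLin f

@[simp] lemma lin_mk (f : A.carrier →ₗ[ℝ] B.carrier) (h h') : lin (⟨f, h, h'⟩ : A ⟶ B) = f := rfl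
@[simp] lemma lin_id : lin (𝟙 A) = LinearMap.id := rfl
@[simp] lemma lin_comp (f : A ⟶ B) (g : B ⟶ C) : lin (f ≫ g) = lin g ∘ₗ lin f := rfl

lemma lin_injective : Function.Injective (lin : (A ⟶ B) → (A.carrier →ₗ[ℝ] B.carrier)) :=
  fun _ _ h => Hom.ext h

instance : Zero (A ⟶ B) := ⟨⟨0, fun _ _ _ => by simp, fun _ _ _ => by simp⟩⟩
instance : Add (A ⟶ B) := ⟨fun f g => ⟨lin f + lin g,
  fun n x h => add_mem (f.map_W n x h) (g.map_W n x h), fun p x h => by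
    rw [LinearMap.baseChange_add]; exact add_mem (f.map_F p x h) (g.map_F p x h)⟩⟩
instance : Neg (A ⟶ B) := ⟨fun f => ⟨-lin f,
  fun n x h => neg_mem (f.map_W n x h), fun p x h => by
    rw [LinearMap.baseChange_neg]; exact neg_mem (f.map_F p x h)⟩⟩
instance : Sub (A ⟶ B) := ⟨fun f g => ⟨lin f - lin g,
  fun n x h => sub_mem (f.map_W n x h) (g.map_W n x h), fun p x h => by
    rw [LinearMap.baseChange_sub]; exact sub_mem (f.map_F p x h) (g.map_F p x h)⟩⟩
instance : SMul ℕ (A ⟶ B) := ⟨fun k f => ⟨k • lin f,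
  fun n x h => nsmul_mem (f.map_W n x h) k, fun p x h => by
    have e : (k • lin f).baseChange ℂ = k • (lin f).baseChange ℂ :=
      map_nsmul (LinearMap.baseChangeHom ℝ ℂ A.carrier B.carrier) k (lin f)
    rw [e]; exact nsmul_mem (f.map_F p x h) k⟩⟩
instance : SMul ℤ (A ⟶ B) := ⟨fun k f => ⟨k • lin f,
  fun n x h => zsmul_mem (f.map_W n x h) k, fun p x h => by
    have e : (k • lin f).baseChange ℂ = k • (lin f).baseChange ℂ :=
      map_zsmul (LinearMap.baseChangeHom ℝ ℂ A.carrier B.carrier) k (lin f)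
    rw [e]; exact zsmul_mem (f.map_F p x h) k⟩⟩

@[simp] lemma lin_zero : lin (0 : A ⟶ B) = 0 := rfl
@[simp] lemma lin_add (f g : A ⟶ B) : lin (f + g) = lin f + lin g := rfl

instance : AddCommGroup (A ⟶ B) :=
  lin_injective.addCommGroup lin rfl (fun _ _ => rfl) (fun _ => rfl) (fun _ _ => rfl)
    (fun _ _ => rfl) (fun _ _ => rfl)

instance : Preadditive RealMHS.{u} where
  add_comp _ _ _ f g h := lin_injective (by simp [LinearMap.comp_add])
  comp_add _ _ _ f g h := lin_injective (by simp [LinearMap.add_comp])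

end RealMHS

namespace MHS

/-! Linear algebra of opposed filtrations. -/

section Abstract

variable {V : Type*} [AddCommGroup V] [Module ℂ V]

lemma isCompl_grFil_iff {W F G : ℤ → Submodule ℂ V} {n p q : ℤ} :
    IsCompl (grFil W F n p) (grFil W G n q) ↔
      (∀ x ∈ W n, ∃ a ∈ F p, a ∈ W n ∧ ∃ b ∈ G q, b ∈ W n ∧ x - a - b ∈ W (n - 1)) ∧
      (∀ a ∈ F p, a ∈ W n → ∀ b ∈ G q, b ∈ W n → a - b ∈ W (n - 1) → a ∈ W (n - 1)) := by
  have key : ∀ x y : ↥(W n), ((W (n - 1)).submoduleOf (W n)).mkQ x =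
      ((W (n - 1)).submoduleOf (W n)).mkQ y ↔ (x : V) - y ∈ W (n - 1) := fun x y => by
    rw [Submodule.mkQ_apply, Submodule.mkQ_apply, Submodule.Quotient.eq]
    rfl
  have key0 : ∀ x : ↥(W n), ((W (n - 1)).submoduleOf (W n)).mkQ x = 0 ↔
      (x : V) ∈ W (n - 1) := fun x => by
    rw [← map_zero ((W (n - 1)).submoduleOf (W n)).mkQ, key]; simp
  rw [isCompl_iff, and_comm]
  refine and_congr ?_ ?_
  · rw [Submodule.codisjoint_iff_exists_add_eq]
    constructor
    · intro h x hx
      obtain ⟨y, z, ⟨a, ha, rfl⟩, ⟨b, hb, rfl⟩, e⟩ := h (Submodule.mkQ _ ⟨x, hx⟩)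
      rw [← map_add, eq_comm, key] at e
      exact ⟨a, ha, a.2, b, hb, b.2, by simpa [sub_sub] using e⟩
    · intro h z
      obtain ⟨x, rfl⟩ := Submodule.mkQ_surjective _ z
      obtain ⟨a, ha, ha', b, hb, hb', e⟩ := h x x.2
      refine ⟨_, _, ⟨⟨a, ha'⟩, ha, rfl⟩, ⟨⟨b, hb'⟩, hb, rfl⟩, ?_⟩
      rw [← map_add, eq_comm, key]
      simpa [sub_sub] using e
  · rw [Submodule.disjoint_def]
    constructor
    · intro h a ha ha' b hb hb' e
      have := h (Submodule.mkQ _ ⟨a, ha'⟩) ⟨⟨a, ha'⟩, ha, rfl⟩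
        ⟨⟨b, hb'⟩, hb, ((key _ _).2 (by simpa using e)).symm⟩
      exact (key0 _).1 this
    · rintro h _ ⟨a, ha, rfl⟩ ⟨b, hb, e⟩
      exact (key0 _).2 (h a ha a.2 b hb b.2 ((key _ _).1 e.symm))

/-- Three finite filtrations with `F`, `G` opposed on `Gr^W`, spelled out on elements. -/
structure OppElem (W F G : ℤ → Submodule ℂ V) : Prop where
  W_mono : Monotone W
  W_bot : ∃ n, W n = ⊥
  W_top : ∃ n, W n = ⊤
  F_anti : Antitone F
  F_bot : ∃ n, F n = ⊥
  F_top : ∃ n, F n = ⊤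
  G_anti : Antitone G
  G_bot : ∃ n, G n = ⊥
  G_top : ∃ n, G n = ⊤
  span : ∀ n p q, p + q = n + 1 →
    ∀ x ∈ W n, ∃ a ∈ F p, a ∈ W n ∧ ∃ b ∈ G q, b ∈ W n ∧ x - a - b ∈ W (n - 1)
  disj : ∀ n p q, p + q = n + 1 →
    ∀ a ∈ F p, a ∈ W n → ∀ b ∈ G q, b ∈ W n → a - b ∈ W (n - 1) → a ∈ W (n - 1)

namespace OppElem

variable {W F G : ℤ → Submodule ℂ V}

lemma opposed (h : OppElem W F G) : Opposed W F G :=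
  fun n p q e => isCompl_grFil_iff.2 ⟨h.span n p q e, h.disj n p q e⟩

lemma symm (h : OppElem W F G) : OppElem W G F where
  W_mono := h.W_mono
  W_bot := h.W_bot
  W_top := h.W_top
  F_anti := h.G_anti
  F_bot := h.G_bot
  F_top := h.G_top
  G_anti := h.F_anti
  G_bot := h.F_bot
  G_top := h.F_top
  span n p q e x hx := by
    obtain ⟨a, ha, ha', b, hb, hb', e'⟩ := h.span n q p (by omega) x hx
    exact ⟨b, hb, hb', a, ha, ha', by rwa [sub_right_comm]⟩
  disj n p q e a ha ha' b hb hb' h' := by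
    have h'' : b - a ∈ W (n - 1) := by
      have := neg_mem h'
      rwa [neg_sub] at this
    have := h.disj n q p (by omega) b hb hb' a ha ha' h''
    simpa using add_mem h' this

lemma W_ind (h : OppElem W F G) {P : ℤ → Prop} (h0 : ∀ m, W m = ⊥ → P m)
    (h1 : ∀ m, P (m - 1) → P m) (m : ℤ) : P m := by
  obtain ⟨m0, hm0⟩ := h.W_bot
  rcases le_total m m0 with hm | hm
  · exact h0 m (le_bot_iff.1 (hm0 ▸ h.W_mono hm))
  · induction m, hm using Int.leInduction with
    | base => exact h0 _ hm0
    | succ n hn ih => exact h1 _ (by simpa using ih)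

/-- A functorial complement of `F p ∩ W m` in `W m`. -/
def U (W G : ℤ → Submodule ℂ V) (p m : ℤ) : Submodule ℂ V :=
  ⨆ (k : ℤ) (_ : k ≤ m), G (k + 1 - p) ⊓ W k

lemma mem_U {p m k : ℤ} (hk : k ≤ m) {x : V} (hG : x ∈ G (k + 1 - p)) (hW : x ∈ W k) :
    x ∈ U W G p m :=
  Submodule.mem_iSup_of_mem k (Submodule.mem_iSup_of_mem hk ⟨hG, hW⟩)

lemma U_mono {p m m' : ℤ} (h : m ≤ m') : U W G p m ≤ U W G p m' :=
  iSup₂_le fun _ hk _ hx => mem_U (hk.trans h) hx.1 hx.2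

lemma U_le (h : OppElem W F G) (p m : ℤ) : U W G p m ≤ W m :=
  iSup₂_le fun _ hk _ hx => h.W_mono hk hx.2

lemma U_split {p m : ℤ} {x : V} (hx : x ∈ U W G p m) :
    ∃ b ∈ G (m + 1 - p), b ∈ W m ∧ ∃ u ∈ U W G p (m - 1), x = b + u := by
  have : U W G p m ≤ (G (m + 1 - p) ⊓ W m) ⊔ U W G p (m - 1) := by
    refine iSup₂_le fun k hk y hy => ?_
    rcases hk.eq_or_lt with rfl | hk
    · exact Submodule.mem_sup_left hy
    · exact Submodule.mem_sup_right (mem_U (by omega) hy.1 hy.2)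
  obtain ⟨b, hb, u, hu, e⟩ := Submodule.mem_sup.1 (this hx)
  exact ⟨b, hb.1, hb.2, u, hu, e.symm⟩

lemma F_U_disj (h : OppElem W F G) (p m : ℤ) :
    ∀ x ∈ F p, x ∈ U W G p m → x = 0 := by
  refine h.W_ind (P := fun m => ∀ x ∈ F p, x ∈ U W G p m → x = 0) ?_ ?_ m
  · intro m hm x _ hx
    simpa [hm] using h.U_le p m hx
  · intro m ih x hF hx
    obtain ⟨b, hb, hb', u, hu, e⟩ := U_split hx
    have hu' := h.U_le _ _ hu
    have hxW : x ∈ W (m - 1) :=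
      h.disj m p (m + 1 - p) (by omega) x hF (h.U_le _ _ hx) b hb hb' (by simpa [e] using hu')
    have hbW : b ∈ W (m - 1) := by
      have : b = x - u := by simp [e]
      rw [this]; exact sub_mem hxW hu'
    refine ih x hF ?_
    rw [e]
    exact add_mem (mem_U le_rfl (h.G_anti (by omega) hb) hbW) hu

lemma F_U_span (h : OppElem W F G) (p m : ℤ) :
    ∀ x ∈ W m, ∃ a ∈ F p, a ∈ W m ∧ ∃ u ∈ U W G p m, x = a + u := by
  refine h.W_ind (P := fun m => ∀ x ∈ W m, ∃ a ∈ F p, a ∈ W m ∧ ∃ u ∈ U W G p m, x = a + u)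
    ?_ ?_ m
  · intro m hm x hx
    have : x = 0 := by simpa [hm] using hx
    exact ⟨0, zero_mem _, zero_mem _, 0, zero_mem _, by simp [this]⟩
  · intro m ih x hx
    obtain ⟨a, ha, ha', b, hb, hb', e⟩ := h.span m p (m + 1 - p) (by omega) x hx
    obtain ⟨a1, ha1, ha1', u, hu, e1⟩ := ih _ e
    refine ⟨a + a1, add_mem ha ha1, add_mem ha' (h.W_mono (by omega) ha1'), b + u,
      add_mem (mem_U le_rfl hb hb') (U_mono (by omega) hu), ?_⟩
    rw [add_add_add_comm, add_comm (a + b), ← add_assoc] at *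
    have : x = (x - a - b) + (a + b) := by abel
    rw [this, e1]; abel

end OppElem

variable {V' : Type*} [AddCommGroup V'] [Module ℂ V']
variable {V'' : Type*} [AddCommGroup V''] [Module ℂ V'']
variable {W F G : ℤ → Submodule ℂ V} {W' F' G' : ℤ → Submodule ℂ V'}

/-- A linear map compatible with three filtrations. -/
structure Compat (W F G : ℤ → Submodule ℂ V) (W' F' G' : ℤ → Submodule ℂ V')
    (f : V →ₗ[ℂ] V') : Prop where
  W : ∀ n, ∀ x ∈ W n, f x ∈ W' n
  F : ∀ n, ∀ x ∈ F n, f x ∈ F' n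
  G : ∀ n, ∀ x ∈ G n, f x ∈ G' n

namespace Compat

open OppElem

variable {f : V →ₗ[ℂ] V'}

lemma symm (c : Compat W F G W' F' G' f) : Compat W G F W' G' F' f := ⟨c.W, c.G, c.F⟩

lemma map_U (c : Compat W F G W' F' G' f) {p m : ℤ} {x : V} (hx : x ∈ U W G p m) :
    f x ∈ U W' G' p m := by
  have : U W G p m ≤ (U W' G' p m).comap f :=
    iSup₂_le fun k hk y hy => mem_U hk (c.G _ _ hy.1) (c.W _ _ hy.2)
  exact this hx

lemma strict_F_aux (c : Compat W F G W' F' G' f) (h : OppElem W F G) (h' : OppElem W' F' G')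
    {p m : ℤ} {x : V} (hx : x ∈ W m) (hfx : f x ∈ F' p) :
    ∃ a ∈ F p, a ∈ W m ∧ f a = f x := by
  obtain ⟨a, ha, ha', u, hu, e⟩ := h.F_U_span p m x hx
  refine ⟨a, ha, ha', ?_⟩
  have hfu : f u = f x - f a := by simp [e]
  have : f u = 0 := h'.F_U_disj p m _ (by rw [hfu]; exact sub_mem hfx (c.F _ _ ha)) (c.map_U hu)
  rw [this] at hfu
  exact (sub_eq_zero.1 hfu.symm).symm

lemma strict_gr (c : Compat W F G W' F' G' f) (h : OppElem W F G) (h' : OppElem W' F' G')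
    {n : ℤ} {x : V} (hx : x ∈ W n) (hfx : f x ∈ W' (n - 1)) :
    ∃ w ∈ W (n - 1), f w = f x := by
  obtain ⟨pt, hpt⟩ := h.F_top
  obtain ⟨pb, hpb⟩ := h.F_bot
  have main : ∀ k : ℕ, ∀ x ∈ F (pb - k), x ∈ W n → f x ∈ W' (n - 1) →
      ∃ w ∈ W (n - 1), f w = f x := by
    intro k
    induction k with
    | zero =>
      intro x hx _ _
      have : x = 0 := by simpa [hpb] using hx
      exact ⟨0, zero_mem _, by simp [this]⟩
    | succ k ih =>
      intro x hx hxW hfx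
      set p : ℤ := pb - (k + 1 : ℕ) with hp
      have hp1 : pb - (k : ℤ) = p + 1 := by push_cast at hp; omega
      rw [hp1] at ih
      obtain ⟨a, ha, ha', b, hb, hb', hw⟩ := h.span n (p + 1) (n - p) (by omega) x hxW
      have hfab : f a + f b ∈ W' (n - 1) := by
        have : f a + f b = f x - f (x - a - b) := by rw [map_sub, map_sub]; abel
        rw [this]; exact sub_mem hfx (c.W _ _ hw)
      have hfa : f a ∈ W' (n - 1) :=
        h'.disj n (p + 1) (n - p) (by omega) _ (c.F _ _ ha) (c.W _ _ ha') (-f b)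
          (neg_mem (c.G _ _ hb)) (neg_mem (c.W _ _ hb')) (by simpa using hfab)
      obtain ⟨w1, hw1, e1⟩ := ih a ha ha' hfa
      have haF : x - a ∈ F p := sub_mem hx (h.F_anti (by omega) ha)
      obtain ⟨d, hd, hd', v, hv, ev⟩ := h.F_U_span p (n - 1) _ hw
      obtain ⟨b', hb1, hb1', u', hu', e2⟩ := U_split hv
      have hGb' : b' ∈ G (n - p) := by convert hb1 using 2; omega
      have hyF : x - a - d ∈ F p := sub_mem haF hd
      have ey : x - a - d = (b + b') + u' := by
        have : x - a = (x - a - b) + b := by abel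
        rw [this, ev, e2]; abel
      have hfy : f (x - a - d) ∈ W' (n - 1) := by
        rw [map_sub, map_sub]
        exact sub_mem (sub_mem hfx hfa) (c.W _ _ hd')
      have hfu' : f u' ∈ U W' G' p (n - 1 - 1) := c.map_U hu'
      have hfbb : f (b + b') ∈ W' (n - 1) := by
        have : f (b + b') = f (x - a - d) - f u' := by rw [ey]; simp
        rw [this]; exact sub_mem hfy (h'.W_mono (by omega) (h'.U_le _ _ hfu'))
      have hy0 : f (x - a - d) = 0 := by
        refine h'.F_U_disj p (n - 1) _ (c.F _ _ hyF) ?_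
        rw [ey, map_add]
        refine add_mem (mem_U le_rfl ?_ hfbb) (U_mono (by omega) hfu')
        convert c.G _ _ (add_mem hb hGb') using 2; omega
      refine ⟨w1 + d, add_mem hw1 hd', ?_⟩
      rw [map_sub, map_sub] at hy0
      rw [map_add, e1]
      have := sub_eq_zero.1 hy0
      rw [← this]; abel
  refine main (pb - pt).toNat x (h.F_anti (a := pb - ((pb - pt).toNat : ℤ)) (b := pt) ?_ ?_) hx hfx
  · omega
  · simp [hpt]

lemma strict_W (c : Compat W F G W' F' G' f) (h : OppElem W F G) (h' : OppElem W' F' G')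
    {m : ℤ} {x : V} (hfx : f x ∈ W' m) : ∃ w ∈ W m, f w = f x := by
  have main : ∀ k : ℕ, ∀ x ∈ W (m + k), f x ∈ W' m → ∃ w ∈ W m, f w = f x := by
    intro k
    induction k with
    | zero => intro x hx _; exact ⟨x, by simpa using hx, rfl⟩
    | succ k ih =>
      intro x hx hfx
      obtain ⟨w, hw, e⟩ := c.strict_gr h h' hx (h'.W_mono (by push_cast; omega) hfx)
      obtain ⟨w', hw', e'⟩ := ih w (h.W_mono (by push_cast; omega) hw) (e ▸ hfx)
      exact ⟨w', hw', e'.trans e⟩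
  obtain ⟨N, hN⟩ := h.W_top
  refine main (N - m).toNat x (h.W_mono (a := N) ?_ ?_) hfx
  · omega
  · simp [hN]

lemma strict_FW (c : Compat W F G W' F' G' f) (h : OppElem W F G) (h' : OppElem W' F' G')
    {p m : ℤ} {x : V} (hF : f x ∈ F' p) (hW : f x ∈ W' m) :
    ∃ a ∈ F p, a ∈ W m ∧ f a = f x := by
  obtain ⟨w, hw, e⟩ := c.strict_W h h' hW
  obtain ⟨a, ha, ha', e'⟩ := c.strict_F_aux h h' hw (e ▸ hF)
  exact ⟨a, ha, ha', e'.trans e⟩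

lemma strict_F (c : Compat W F G W' F' G' f) (h : OppElem W F G) (h' : OppElem W' F' G')
    {p : ℤ} {x : V} (hF : f x ∈ F' p) : ∃ a ∈ F p, f a = f x := by
  obtain ⟨N, hN⟩ := h.W_top
  obtain ⟨a, ha, -, e⟩ := c.strict_F_aux h h' (m := N) (by simp [hN]) hF
  exact ⟨a, ha, e⟩

lemma comap_oppElem (c : Compat W F G W' F' G' f) (h : OppElem W F G) (h' : OppElem W' F' G')
    (i : V'' →ₗ[ℂ] V) (hi : Function.Injective i) (hfi : ∀ x, f (i x) = 0)
    (hex : ∀ x, f x = 0 → ∃ y, i y = x) :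
    OppElem (fun n => (W n).comap i) (fun n => (F n).comap i) (fun n => (G n).comap i) where
  W_mono _ _ e := Submodule.comap_mono (h.W_mono e)
  W_bot := h.W_bot.imp fun n e => by simp [e, LinearMap.ker_eq_bot.2 hi]
  W_top := h.W_top.imp fun n e => by simp [e]
  F_anti _ _ e := Submodule.comap_mono (h.F_anti e)
  F_bot := h.F_bot.imp fun n e => by simp [e, LinearMap.ker_eq_bot.2 hi]
  F_top := h.F_top.imp fun n e => by simp [e]
  G_anti _ _ e := Submodule.comap_mono (h.G_anti e)
  G_bot := h.G_bot.imp fun n e => by simp [e, LinearMap.ker_eq_bot.2 hi]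
  G_top := h.G_top.imp fun n e => by simp [e]
  span n p q e x hx := by
    obtain ⟨a, ha, ha', b, hb, hb', hw⟩ := h.span n p q e (i x) hx
    have hfab : f a + f b ∈ W' (n - 1) := by
      have : f a + f b = f (i x) - f (i x - a - b) := by rw [map_sub, map_sub]; abel
      rw [this, hfi, zero_sub]; exact neg_mem (c.W _ _ hw)
    have hfa : f a ∈ W' (n - 1) :=
      h'.disj n p q e _ (c.F _ _ ha) (c.W _ _ ha') (-f b)
        (neg_mem (c.G _ _ hb)) (neg_mem (c.W _ _ hb')) (by simpa using hfab)
    have hfb : f b ∈ W' (n - 1) := by simpa using sub_mem hfab hfa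
    obtain ⟨a0, ha0, ha0', ea⟩ := c.strict_FW h h' (c.F _ _ ha) hfa
    obtain ⟨b0, hb0, hb0', eb⟩ := c.symm.strict_FW h.symm h'.symm (c.G _ _ hb) hfb
    obtain ⟨a1, ea1⟩ := hex (a - a0) (by simp [ea])
    obtain ⟨b1, eb1⟩ := hex (b - b0) (by simp [eb])
    have hle : W (n - 1) ≤ W n := h.W_mono (by omega)
    refine ⟨a1, ?_, ?_, b1, ?_, ?_, ?_⟩ <;>
      simp only [Submodule.mem_comap, map_sub, ea1, eb1]
    · exact sub_mem ha ha0
    · exact sub_mem ha' (hle ha0')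
    · exact sub_mem hb hb0
    · exact sub_mem hb' (hle hb0')
    · have : i x - (a - a0) - (b - b0) = (i x - a - b) + a0 + b0 := by abel
      rw [this]; exact add_mem (add_mem hw ha0') hb0'
  disj n p q e a ha ha' b hb hb' hw :=
    h.disj n p q e (i a) ha ha' (i b) hb hb' (by simpa using hw)

lemma map_lift (c : Compat W F G W' F' G' f) (h : OppElem W F G) (h' : OppElem W' F' G')
    (r : V' →ₗ[ℂ] V'') (hrf : ∀ x, r (f x) = 0) (hex : ∀ y, r y = 0 → ∃ x, f x = y)
    {n p : ℤ} {z : V''} (hF : z ∈ (F' p).map r) (hW : z ∈ (W' n).map r) :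
    ∃ a ∈ F' p, a ∈ W' n ∧ r a = z := by
  obtain ⟨a, ha, rfl⟩ := hF
  obtain ⟨w, hw, e⟩ := hW
  obtain ⟨x, hx⟩ := hex (a - w) (by simp [e])
  obtain ⟨N0, hN0⟩ := h.W_top
  obtain ⟨w1, hw1, hw1', w2, hw2, e2⟩ := h'.F_U_span p n w hw
  obtain ⟨x1, hx1, -, x2, hx2, ex⟩ := h.F_U_span p (max N0 n) x
    (h.W_mono (le_max_left _ _) (by simp [hN0]))
  have hz : f x2 + w2 = 0 := by
    have e3 : f x2 + w2 = a - w1 - f x1 := by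
      have : f x2 = f x - f x1 := by simp [ex]
      rw [this, hx, e2]; abel
    refine h'.F_U_disj p (max N0 n) _ ?_
      (add_mem (c.map_U hx2) (U_mono (le_max_right _ _) hw2))
    rw [e3]; exact sub_mem (sub_mem ha hw1) (c.F _ _ hx1)
  refine ⟨w1, hw1, hw1', ?_⟩
  have hw2' : w2 = -f x2 := (neg_eq_of_add_eq_zero_right hz).symm
  rw [← e, e2, hw2', map_add, map_neg, hrf]; simp

lemma map_oppElem (c : Compat W F G W' F' G' f) (h : OppElem W F G) (h' : OppElem W' F' G')
    (r : V' →ₗ[ℂ] V'') (hr : Function.Surjective r) (hrf : ∀ x, r (f x) = 0)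
    (hex : ∀ y, r y = 0 → ∃ x, f x = y) :
    OppElem (fun n => (W' n).map r) (fun n => (F' n).map r) (fun n => (G' n).map r) where
  W_mono _ _ e := Submodule.map_mono (h'.W_mono e)
  W_bot := h'.W_bot.imp fun n e => by simp [e]
  W_top := h'.W_top.imp fun n e => by simp [e, LinearMap.range_eq_top.2 hr]
  F_anti _ _ e := Submodule.map_mono (h'.F_anti e)
  F_bot := h'.F_bot.imp fun n e => by simp [e]
  F_top := h'.F_top.imp fun n e => by simp [e, LinearMap.range_eq_top.2 hr]
  G_anti _ _ e := Submodule.map_mono (h'.G_anti e)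
  G_bot := h'.G_bot.imp fun n e => by simp [e]
  G_top := h'.G_top.imp fun n e => by simp [e, LinearMap.range_eq_top.2 hr]
  span n p q e z hz := by
    obtain ⟨x, hx, rfl⟩ := hz
    obtain ⟨a, ha, ha', b, hb, hb', hw⟩ := h'.span n p q e x hx
    exact ⟨r a, ⟨a, ha, rfl⟩, ⟨a, ha', rfl⟩, r b, ⟨b, hb, rfl⟩, ⟨b, hb', rfl⟩,
      ⟨_, hw, by simp⟩⟩
  disj n p q e a₀ ha₀ ha₀' b₀ hb₀ hb₀' hw₀ := by
    obtain ⟨a, ha, ha', rfl⟩ := c.map_lift h h' r hrf hex ha₀ ha₀'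
    obtain ⟨b, hb, hb', rfl⟩ := c.symm.map_lift h.symm h'.symm r hrf hex hb₀ hb₀'
    obtain ⟨w, hw, ew⟩ := hw₀
    have hle : W' (n - 1) ≤ W' n := h'.W_mono (by omega)
    obtain ⟨x₀, hx₀⟩ := hex (a - b - w) (by simp [ew])
    obtain ⟨x, hx, hfx⟩ := c.strict_W h h' (m := n) (x := x₀)
      (by rw [hx₀]; exact sub_mem (sub_mem ha' hb') (hle hw))
    obtain ⟨xa, hxa, hxa', xb, hxb, hxb', hxw⟩ := h.span n p q e x hx
    have key : a - f xa ∈ W' (n - 1) := by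
      refine h'.disj n p q e _ (sub_mem ha (c.F _ _ hxa)) (sub_mem ha' (c.W _ _ hxa'))
        (b + f xb) (add_mem hb (c.G _ _ hxb)) (add_mem hb' (c.W _ _ hxb')) ?_
      have : a - f xa - (b + f xb) = w + f (x - xa - xb) := by
        have e1 : a - b = f x + w := by rw [hfx, hx₀]; abel
        have : a - f xa - (b + f xb) = (a - b) - f xa - f xb := by abel
        rw [this, e1, map_sub, map_sub]; abel
      rw [this]; exact add_mem hw (c.W _ _ hxw)
    exact ⟨_, key, by simp [hrf]⟩

end Compat

lemma OppElem.prod {W₁ F₁ G₁ : ℤ → Submodule ℂ V} {W₂ F₂ G₂ : ℤ → Submodule ℂ V'}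
    (h₁ : OppElem W₁ F₁ G₁) (h₂ : OppElem W₂ F₂ G₂)
    (r₁ : V'' →ₗ[ℂ] V) (r₂ : V'' →ₗ[ℂ] V') (hinj : ∀ z, r₁ z = 0 → r₂ z = 0 → z = 0)
    (hsurj : ∀ x y, ∃ z, r₁ z = x ∧ r₂ z = y) :
    OppElem (fun n => (W₁ n).comap r₁ ⊓ (W₂ n).comap r₂)
      (fun n => (F₁ n).comap r₁ ⊓ (F₂ n).comap r₂)
      (fun n => (G₁ n).comap r₁ ⊓ (G₂ n).comap r₂) := by
  have bot : ∀ {S₁ : ℤ → Submodule ℂ V} {S₂ : ℤ → Submodule ℂ V'} {n m k : ℤ},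
      S₁ n = ⊥ → S₂ m = ⊥ → S₁ k ≤ S₁ n → S₂ k ≤ S₂ m →
      (S₁ k).comap r₁ ⊓ (S₂ k).comap r₂ = ⊥ := by
    intro S₁ S₂ n m k e₁ e₂ l₁ l₂
    rw [e₁] at l₁
    rw [e₂] at l₂
    refine le_bot_iff.1 fun z hz => ?_
    exact hinj z (l₁ hz.1) (l₂ hz.2)
  have top : ∀ {S₁ : ℤ → Submodule ℂ V} {S₂ : ℤ → Submodule ℂ V'} {n m k : ℤ},
      S₁ n = ⊤ → S₂ m = ⊤ → S₁ n ≤ S₁ k → S₂ m ≤ S₂ k →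
      (S₁ k).comap r₁ ⊓ (S₂ k).comap r₂ = ⊤ := by
    intro S₁ S₂ n m k e₁ e₂ l₁ l₂
    rw [e₁] at l₁
    rw [e₂] at l₂
    exact top_le_iff.1 fun z _ => ⟨l₁ trivial, l₂ trivial⟩
  refine ⟨?_, ?_, ?_, ?_, ?_, ?_, ?_, ?_, ?_, ?_, ?_⟩
  · exact fun _ _ e => inf_le_inf (Submodule.comap_mono (h₁.W_mono e))
      (Submodule.comap_mono (h₂.W_mono e))
  · obtain ⟨n, hn⟩ := h₁.W_bot
    obtain ⟨m, hm⟩ := h₂.W_bot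
    exact ⟨min n m, bot hn hm (h₁.W_mono (min_le_left _ _)) (h₂.W_mono (min_le_right _ _))⟩
  · obtain ⟨n, hn⟩ := h₁.W_top
    obtain ⟨m, hm⟩ := h₂.W_top
    exact ⟨max n m, top hn hm (h₁.W_mono (le_max_left _ _)) (h₂.W_mono (le_max_right _ _))⟩
  · exact fun _ _ e => inf_le_inf (Submodule.comap_mono (h₁.F_anti e))
      (Submodule.comap_mono (h₂.F_anti e))
  · obtain ⟨n, hn⟩ := h₁.F_bot
    obtain ⟨m, hm⟩ := h₂.F_bot
    exact ⟨max n m, bot hn hm (h₁.F_anti (le_max_left _ _)) (h₂.F_anti (le_max_right _ _))⟩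
  · obtain ⟨n, hn⟩ := h₁.F_top
    obtain ⟨m, hm⟩ := h₂.F_top
    exact ⟨min n m, top hn hm (h₁.F_anti (min_le_left _ _)) (h₂.F_anti (min_le_right _ _))⟩
  · exact fun _ _ e => inf_le_inf (Submodule.comap_mono (h₁.G_anti e))
      (Submodule.comap_mono (h₂.G_anti e))
  · obtain ⟨n, hn⟩ := h₁.G_bot
    obtain ⟨m, hm⟩ := h₂.G_bot
    exact ⟨max n m, bot hn hm (h₁.G_anti (le_max_left _ _)) (h₂.G_anti (le_max_right _ _))⟩
  · obtain ⟨n, hn⟩ := h₁.G_top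
    obtain ⟨m, hm⟩ := h₂.G_top
    exact ⟨min n m, top hn hm (h₁.G_anti (min_le_left _ _)) (h₂.G_anti (min_le_right _ _))⟩
  · intro n p q e z hz
    obtain ⟨a₁, ha₁, ha₁', b₁, hb₁, hb₁', hw₁⟩ := h₁.span n p q e _ hz.1
    obtain ⟨a₂, ha₂, ha₂', b₂, hb₂, hb₂', hw₂⟩ := h₂.span n p q e _ hz.2
    obtain ⟨a, rfl, rfl⟩ := hsurj a₁ a₂
    obtain ⟨b, rfl, rfl⟩ := hsurj b₁ b₂
    exact ⟨a, ⟨ha₁, ha₂⟩, ⟨ha₁', ha₂'⟩, b, ⟨hb₁, hb₂⟩, ⟨hb₁', hb₂'⟩,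
      ⟨by simpa using hw₁, by simpa using hw₂⟩⟩
  · intro n p q e a ha ha' b hb hb' hw
    exact ⟨h₁.disj n p q e _ ha.1 ha'.1 _ hb.1 hb'.1 (by simpa using hw.1),
      h₂.disj n p q e _ ha.2 ha'.2 _ hb.2 hb'.2 (by simpa using hw.2)⟩

end Abstract

/-! Real and imaginary parts on `ℂ ⊗ H`. -/

section Complexification

variable {H : Type*} [AddCommGroup H] [Module ℝ H] {H' : Type*} [AddCommGroup H'] [Module ℝ H']

/-- The real part `ℂ ⊗ H → H`. -/
noncomputable def re : ℂ ⊗[ℝ] H →ₗ[ℝ] H :=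
  (TensorProduct.lid ℝ H).toLinearMap ∘ₗ LinearMap.rTensor H Complex.reLm

/-- The imaginary part `ℂ ⊗ H → H`. -/
noncomputable def im : ℂ ⊗[ℝ] H →ₗ[ℝ] H :=
  (TensorProduct.lid ℝ H).toLinearMap ∘ₗ LinearMap.rTensor H Complex.imLm

@[simp] lemma re_tmul (c : ℂ) (h : H) : re (c ⊗ₜ[ℝ] h) = c.re • h := by simp [re]
@[simp] lemma im_tmul (c : ℂ) (h : H) : im (c ⊗ₜ[ℝ] h) = c.im • h := by simp [im]
@[simp] lemma conj_tmul (c : ℂ) (h : H) :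
    conj H (c ⊗ₜ[ℝ] h) = (starRingEnd ℂ c) ⊗ₜ[ℝ] h := rfl

lemma eq_re_im (z : ℂ ⊗[ℝ] H) : z = 1 ⊗ₜ[ℝ] re z + Complex.I ⊗ₜ[ℝ] im z := by
  induction z with
  | zero => simp
  | tmul c h =>
    rw [re_tmul, im_tmul, ← TensorProduct.smul_tmul, ← TensorProduct.smul_tmul,
      ← TensorProduct.add_tmul]
    congr 1
    simp
  | add x y hx hy =>
    rw [map_add, map_add, TensorProduct.tmul_add, TensorProduct.tmul_add]
    nth_rewrite 1 [hx, hy]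
    abel

lemma ext_re_im {z z' : ℂ ⊗[ℝ] H} (h : re z = re z') (h' : im z = im z') : z = z' := by
  rw [eq_re_im z, eq_re_im z', h, h']

lemma re_baseChange (f : H →ₗ[ℝ] H') (z : ℂ ⊗[ℝ] H) : re (f.baseChange ℂ z) = f (re z) := by
  induction z with
  | zero => simp
  | tmul c h => simp
  | add x y hx hy => simp only [map_add, hx, hy]

lemma im_baseChange (f : H →ₗ[ℝ] H') (z : ℂ ⊗[ℝ] H) : im (f.baseChange ℂ z) = f (im z) := by
  induction z with
  | zero => simp
  | tmul c h => simp
  | add x y hx hy => simp only [map_add, hx, hy]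

lemma conj_baseChange (f : H →ₗ[ℝ] H') (z : ℂ ⊗[ℝ] H) :
    conj H' (f.baseChange ℂ z) = f.baseChange ℂ (conj H z) := by
  induction z with
  | zero => simp
  | tmul c h => simp
  | add x y hx hy => simp only [map_add, hx, hy]

@[simp] lemma conj_conj (z : ℂ ⊗[ℝ] H) : conj H (conj H z) = z := by
  induction z with
  | zero => simp
  | tmul c h => simp
  | add x y hx hy => simp only [map_add, hx, hy]

lemma mem_map_conj {S : Submodule ℂ (ℂ ⊗[ℝ] H)} {z : ℂ ⊗[ℝ] H} :
    z ∈ S.map (conj H) ↔ conj H z ∈ S := by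
  constructor
  · rintro ⟨y, hy, rfl⟩
    simpa using hy
  · intro h
    exact ⟨_, h, conj_conj z⟩

lemma mem_baseChange_iff {S : Submodule ℝ H} {z : ℂ ⊗[ℝ] H} :
    z ∈ S.baseChange ℂ ↔ re z ∈ S ∧ im z ∈ S := by
  constructor
  · intro hz
    rw [Submodule.baseChange_eq_span] at hz
    induction hz using Submodule.span_induction with
    | mem x hx =>
      obtain ⟨y, hy, rfl⟩ := hx
      have hy' : y ∈ S := hy
      simp [hy']
    | zero => simp
    | add x y _ _ hx hy =>
      rw [map_add, map_add]
      exact ⟨add_mem hx.1 hy.1, add_mem hx.2 hy.2⟩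
    | smul c x _ hx =>
      have e : c • x = (c * 1) ⊗ₜ[ℝ] re x + (c * Complex.I) ⊗ₜ[ℝ] im x := by
        conv_lhs => rw [eq_re_im x]
        simp [TensorProduct.smul_tmul']
      rw [e, map_add, map_add, re_tmul, re_tmul, im_tmul, im_tmul]
      exact ⟨add_mem (S.smul_mem _ hx.1) (S.smul_mem _ hx.2),
        add_mem (S.smul_mem _ hx.1) (S.smul_mem _ hx.2)⟩
  · rintro ⟨h1, h2⟩
    rw [eq_re_im z]
    exact add_mem (Submodule.tmul_mem_baseChange_of_mem _ h1)
      (Submodule.tmul_mem_baseChange_of_mem _ h2)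

lemma baseChange_comap (f : H →ₗ[ℝ] H') (S : Submodule ℝ H') :
    (S.comap f).baseChange ℂ = (S.baseChange ℂ).comap (f.baseChange ℂ) := by
  ext z
  simp [mem_baseChange_iff, re_baseChange, im_baseChange]

lemma baseChange_map (f : H →ₗ[ℝ] H') (S : Submodule ℝ H) :
    (S.map f).baseChange ℂ = (S.baseChange ℂ).map (f.baseChange ℂ) := by
  ext z
  rw [mem_baseChange_iff]
  constructor
  · rintro ⟨⟨x, hx, ex⟩, ⟨y, hy, ey⟩⟩
    refine ⟨1 ⊗ₜ[ℝ] x + Complex.I ⊗ₜ[ℝ] y, add_mem (Submodule.tmul_mem_baseChange_of_mem _ hx)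
      (Submodule.tmul_mem_baseChange_of_mem _ hy), ?_⟩
    rw [map_add, LinearMap.baseChange_tmul, LinearMap.baseChange_tmul, ex, ey, ← eq_re_im]
  · rintro ⟨w, hw, rfl⟩
    rw [SetLike.mem_coe, mem_baseChange_iff] at hw
    rw [re_baseChange, im_baseChange]
    exact ⟨⟨_, hw.1, rfl⟩, ⟨_, hw.2, rfl⟩⟩

lemma baseChange_inf (S T : Submodule ℝ H) :
    (S ⊓ T).baseChange ℂ = S.baseChange ℂ ⊓ T.baseChange ℂ := by
  ext z
  simp only [mem_baseChange_iff, Submodule.mem_inf]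
  tauto

lemma conj_comap (f : H →ₗ[ℝ] H') (S : Submodule ℂ (ℂ ⊗[ℝ] H')) :
    (S.comap (f.baseChange ℂ)).map (conj H) = (S.map (conj H')).comap (f.baseChange ℂ) := by
  ext z
  simp [mem_map_conj, conj_baseChange, -Submodule.mem_map]

lemma conj_map (f : H →ₗ[ℝ] H') (S : Submodule ℂ (ℂ ⊗[ℝ] H)) :
    (S.map (f.baseChange ℂ)).map (conj H') = (S.map (conj H)).map (f.baseChange ℂ) := by
  ext z
  rw [mem_map_conj]
  constructor
  · rintro ⟨x, hx, e⟩
    exact ⟨conj H x, ⟨x, hx, rfl⟩, by rw [← conj_baseChange, e, conj_conj]⟩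
  · rintro ⟨_, ⟨x, hx, rfl⟩, rfl⟩
    exact ⟨x, hx, by rw [conj_baseChange, conj_conj]⟩

lemma conj_inf (S T : Submodule ℂ (ℂ ⊗[ℝ] H)) :
    (S ⊓ T).map (conj H) = S.map (conj H) ⊓ T.map (conj H) := by
  ext z
  simp only [mem_map_conj, Submodule.mem_inf]

lemma baseChange_injective {f : H →ₗ[ℝ] H'} (hf : Function.Injective f) :
    Function.Injective (f.baseChange ℂ) := by
  intro x y e
  refine ext_re_im (hf ?_) (hf ?_)
  · rw [← re_baseChange, e, re_baseChange]
  · rw [← im_baseChange, e, im_baseChange]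

lemma baseChange_lift {f : H →ₗ[ℝ] H'} {z : ℂ ⊗[ℝ] H'} (h1 : ∃ x, f x = re z)
    (h2 : ∃ x, f x = im z) : ∃ w, f.baseChange ℂ w = z := by
  obtain ⟨x, hx⟩ := h1
  obtain ⟨y, hy⟩ := h2
  exact ⟨1 ⊗ₜ[ℝ] x + Complex.I ⊗ₜ[ℝ] y, by
    rw [map_add, LinearMap.baseChange_tmul, LinearMap.baseChange_tmul, hx, hy, ← eq_re_im]⟩

end Complexification

end MHS

namespace RealMHS

open MHS

variable {A B C : RealMHS.{u}}

/-- The complexified weight filtration. -/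
noncomputable def WC (A : RealMHS.{u}) (n : ℤ) : Submodule ℂ (ℂ ⊗[ℝ] A.carrier) :=
  (A.W n).baseChange ℂ

/-- The conjugate of the Hodge filtration. -/
noncomputable def conjF (A : RealMHS.{u}) (q : ℤ) : Submodule ℂ (ℂ ⊗[ℝ] A.carrier) :=
  (A.F q).map (conj A.carrier)

lemma oppElem (A : RealMHS.{u}) : OppElem A.WC A.F A.conjF where
  W_mono _ _ e := Submodule.baseChange_mono ℂ (A.W_mono e)
  W_bot := A.W_bot.imp fun n e => by simp [WC, e]
  W_top := A.W_top.imp fun n e => by simp [WC, e]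
  F_anti := A.F_anti
  F_bot := A.F_bot
  F_top := A.F_top
  G_anti _ _ e := Submodule.map_mono (A.F_anti e)
  G_bot := A.F_bot.imp fun n e => by simp [conjF, e]
  G_top := A.F_top.imp fun n e => top_le_iff.1 fun z _ => mem_map_conj.2 (by simp [e])
  span n p q e := (isCompl_grFil_iff.1 (A.opposed n p q e)).1
  disj n p q e := (isCompl_grFil_iff.1 (A.opposed n p q e)).2

lemma compat (f : A ⟶ B) :
    Compat A.WC A.F A.conjF B.WC B.F B.conjF ((lin f).baseChange ℂ) where
  W n x hx := by
    rw [WC, mem_baseChange_iff] at hx ⊢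
    rw [re_baseChange, im_baseChange]
    exact ⟨f.map_W _ _ hx.1, f.map_W _ _ hx.2⟩
  F n x hx := f.map_F n x hx
  G n x hx := by
    rw [conjF, mem_map_conj] at hx ⊢
    rw [conj_baseChange]
    exact f.map_F n _ hx

/-- Morphisms are strict for the weight filtration. -/
lemma Hom.strict_W (f : A ⟶ B) {n : ℤ} {x : A.carrier} (h : lin f x ∈ B.W n) :
    ∃ a ∈ A.W n, lin f a = lin f x := by
  obtain ⟨w, hw, e⟩ := (compat f).strict_W A.oppElem B.oppElem (m := n) (x := 1 ⊗ₜ[ℝ] x)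
    (by rw [LinearMap.baseChange_tmul]; exact Submodule.tmul_mem_baseChange_of_mem _ h)
  refine ⟨re w, (mem_baseChange_iff.1 hw).1, ?_⟩
  rw [← re_baseChange, e]
  simp

/-- Morphisms are strict for the Hodge filtration. -/
lemma Hom.strict_F (f : A ⟶ B) {p : ℤ} {x : ℂ ⊗[ℝ] A.carrier}
    (h : (lin f).baseChange ℂ x ∈ B.F p) :
    ∃ a ∈ A.F p, (lin f).baseChange ℂ a = (lin f).baseChange ℂ x :=
  (compat f).strict_F A.oppElem B.oppElem h

/-- Morphisms are strict for the conjugate of the Hodge filtration. -/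
lemma Hom.strict_conjF (f : A ⟶ B) {p : ℤ} {x : ℂ ⊗[ℝ] A.carrier}
    (h : (lin f).baseChange ℂ x ∈ B.conjF p) :
    ∃ a ∈ A.conjF p, (lin f).baseChange ℂ a = (lin f).baseChange ℂ x :=
  (compat f).symm.strict_F A.oppElem.symm B.oppElem.symm h

/-- A constructor from opposedness on elements. -/
noncomputable def ofOppElem (H : Type u) [AddCommGroup H] [Module ℝ H] [FiniteDimensional ℝ H]
    (W : ℤ → Submodule ℝ H) (F : ℤ → Submodule ℂ (ℂ ⊗[ℝ] H)) (hm : Monotone W)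
    (hb : ∃ n, W n = ⊥) (ht : ∃ n, W n = ⊤)
    (h : OppElem (fun n => (W n).baseChange ℂ) F (fun n => (F n).map (conj H))) : RealMHS.{u} where
  carrier := H
  W := W
  F := F
  W_mono := hm
  W_bot := hb
  W_top := ht
  F_anti := h.F_anti
  F_bot := h.F_bot
  F_top := h.F_top
  opposed := h.opposed

/-- The zero object. -/
noncomputable def zeroObj : RealMHS.{u} :=
  ofOppElem PUnit (fun _ => ⊥) (fun _ => ⊥) monotone_const ⟨0, rfl⟩ ⟨0, Subsingleton.elim _ _⟩
    (by
      have : Subsingleton (ℂ ⊗[ℝ] (PUnit : Type u)) :=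
        ⟨fun a b => ext_re_im (Subsingleton.elim _ _) (Subsingleton.elim _ _)⟩
      have hs : Subsingleton (Submodule ℂ (ℂ ⊗[ℝ] (PUnit : Type u))) := inferInstance
      refine ⟨fun _ _ _ => le_of_eq (hs.elim _ _), ⟨0, hs.elim _ _⟩, ⟨0, hs.elim _ _⟩,
        fun _ _ _ => le_of_eq (hs.elim _ _), ⟨0, hs.elim _ _⟩, ⟨0, hs.elim _ _⟩,
        fun _ _ _ => le_of_eq (hs.elim _ _), ⟨0, hs.elim _ _⟩, ⟨0, hs.elim _ _⟩, ?_, ?_⟩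
      · intro n p q _ x _
        exact ⟨0, zero_mem _, zero_mem _, 0, zero_mem _, zero_mem _,
          by rw [Subsingleton.elim (x - 0 - 0) 0]; exact zero_mem _⟩
      · intro n p q _ a _ _ _ _ _ _
        rw [Subsingleton.elim a 0]; exact zero_mem _)

instance : HasZeroObject RealMHS.{u} where
  zero := ⟨zeroObj, by
    have h : 𝟙 (zeroObj.{u}) = 0 :=
      lin_injective (LinearMap.ext fun x => @Subsingleton.elim PUnit _ _ _)
    exact (IsZero.iff_id_eq_zero _).2 h⟩

/-- The direct sum of two real mixed Hodge structures. -/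
noncomputable def prodObj (A B : RealMHS.{u}) : RealMHS.{u} :=
  ofOppElem (A.carrier × B.carrier)
    (fun n => (A.W n).comap (LinearMap.fst ℝ _ _) ⊓ (B.W n).comap (LinearMap.snd ℝ _ _))
    (fun n => (A.F n).comap ((LinearMap.fst ℝ A.carrier B.carrier).baseChange ℂ) ⊓
      (B.F n).comap ((LinearMap.snd ℝ A.carrier B.carrier).baseChange ℂ))
    (fun _ _ e => inf_le_inf (Submodule.comap_mono (A.W_mono e))
      (Submodule.comap_mono (B.W_mono e)))
    (by
      obtain ⟨n, hn⟩ := A.W_bot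
      obtain ⟨m, hm⟩ := B.W_bot
      refine ⟨min n m, le_bot_iff.1 fun z hz => ?_⟩
      have h1 := A.W_mono (min_le_left n m) hz.1
      have h2 := B.W_mono (min_le_right n m) hz.2
      rw [hn] at h1
      rw [hm] at h2
      exact Prod.ext h1 h2)
    (by
      obtain ⟨n, hn⟩ := A.W_top
      obtain ⟨m, hm⟩ := B.W_top
      refine ⟨max n m, top_le_iff.1 fun z _ => ⟨A.W_mono (le_max_left n m) ?_,
        B.W_mono (le_max_right n m) ?_⟩⟩
      · rw [hn]; trivial
      · rw [hm]; trivial)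
    (by
      have := A.oppElem.prod B.oppElem ((LinearMap.fst ℝ A.carrier B.carrier).baseChange ℂ)
        ((LinearMap.snd ℝ A.carrier B.carrier).baseChange ℂ)
        (fun z h1 h2 => ext_re_im
          (Prod.ext (by
              have := congrArg re h1
              rw [re_baseChange] at this
              simpa using this)
            (by
              have := congrArg re h2
              rw [re_baseChange] at this
              simpa using this))
          (Prod.ext (by
              have := congrArg im h1
              rw [im_baseChange] at this
              simpa using this)
            (by
              have := congrArg im h2
              rw [im_baseChange] at this
              simpa using this)))
        (fun x y => ⟨(LinearMap.inl ℝ A.carrier B.carrier).baseChange ℂ x +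
          (LinearMap.inr ℝ A.carrier B.carrier).baseChange ℂ y, by
            simp [← LinearMap.comp_apply, ← LinearMap.baseChange_comp], by
            simp [← LinearMap.comp_apply, ← LinearMap.baseChange_comp]⟩)
      simpa only [WC, conjF, baseChange_inf, baseChange_comap, conj_inf, conj_comap] using this)

lemma inl_mem (A B : RealMHS.{u}) {n : ℤ} {x : ℂ ⊗[ℝ] A.carrier} (h : x ∈ A.F n) :
    (LinearMap.inl ℝ A.carrier B.carrier).baseChange ℂ x ∈
      (A.F n).comap ((LinearMap.fst ℝ A.carrier B.carrier).baseChange ℂ) ⊓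
      (B.F n).comap ((LinearMap.snd ℝ A.carrier B.carrier).baseChange ℂ) := by
  rw [Submodule.mem_inf, Submodule.mem_comap, Submodule.mem_comap, ← LinearMap.comp_apply,
    ← LinearMap.comp_apply, ← LinearMap.baseChange_comp, ← LinearMap.baseChange_comp]
  simpa using h

lemma inr_mem (A B : RealMHS.{u}) {n : ℤ} {x : ℂ ⊗[ℝ] B.carrier} (h : x ∈ B.F n) :
    (LinearMap.inr ℝ A.carrier B.carrier).baseChange ℂ x ∈
      (A.F n).comap ((LinearMap.fst ℝ A.carrier B.carrier).baseChange ℂ) ⊓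
      (B.F n).comap ((LinearMap.snd ℝ A.carrier B.carrier).baseChange ℂ) := by
  rw [Submodule.mem_inf, Submodule.mem_comap, Submodule.mem_comap, ← LinearMap.comp_apply,
    ← LinearMap.comp_apply, ← LinearMap.baseChange_comp, ← LinearMap.baseChange_comp]
  simpa using h

instance : HasBinaryBiproducts RealMHS.{u} := ⟨fun A B => by
  let b : BinaryBicone A B :=
    { pt := prodObj A B
      fst := ⟨LinearMap.fst ℝ A.carrier B.carrier, fun n x h => h.1, fun n x h => h.1⟩
      snd := ⟨LinearMap.snd ℝ A.carrier B.carrier, fun n x h => h.2, fun n x h => h.2⟩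
      inl := ⟨LinearMap.inl ℝ A.carrier B.carrier, fun n x h => ⟨h, zero_mem (B.W n)⟩,
        fun n x h => inl_mem A B h⟩
      inr := ⟨LinearMap.inr ℝ A.carrier B.carrier, fun n x h => ⟨zero_mem (A.W n), h⟩,
        fun n x h => inr_mem A B h⟩
      inl_fst := lin_injective (LinearMap.ext fun x => rfl)
      inl_snd := lin_injective (LinearMap.ext fun x => rfl)
      inr_fst := lin_injective (LinearMap.ext fun x => rfl)
      inr_snd := lin_injective (LinearMap.ext fun x => rfl) }
  refine HasBinaryBiproduct.mk ⟨b, isBinaryBilimitOfTotal b ?_⟩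
  exact lin_injective (LinearMap.ext fun x => Prod.ext
    (show x.1 + 0 = x.1 from add_zero _) (show 0 + x.2 = x.2 from zero_add _))⟩

/-- The kernel of a morphism, with the induced filtrations. -/
noncomputable def kerObj (f : A ⟶ B) : RealMHS.{u} :=
  ofOppElem ↥(LinearMap.ker (lin f)) (fun n => (A.W n).comap (Submodule.subtype _))
    (fun n => (A.F n).comap ((Submodule.subtype (LinearMap.ker (lin f))).baseChange ℂ))
    (fun _ _ e => Submodule.comap_mono (A.W_mono e))
    (A.W_bot.imp fun n e => by simp [e])
    (A.W_top.imp fun n e => by simp [e])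
    (by
      have := (compat f).comap_oppElem A.oppElem B.oppElem
        ((Submodule.subtype (LinearMap.ker (lin f))).baseChange ℂ)
        (baseChange_injective (Submodule.subtype_injective _))
        (fun x => by
          rw [← LinearMap.comp_apply, ← LinearMap.baseChange_comp, LinearMap.comp_ker_subtype]
          simp)
        (fun x hx => by
          refine baseChange_lift ⟨⟨re x, ?_⟩, rfl⟩ ⟨⟨im x, ?_⟩, rfl⟩
          · rw [LinearMap.mem_ker, ← re_baseChange, hx, map_zero]
          · rw [LinearMap.mem_ker, ← im_baseChange, hx, map_zero])
      simpa only [WC, conjF, baseChange_comap, conj_comap] using this)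

/-- The inclusion of the kernel. -/
noncomputable def kerι (f : A ⟶ B) : kerObj f ⟶ A :=
  ⟨Submodule.subtype (LinearMap.ker (lin f)), fun _ _ h => h, fun _ _ h => h⟩

lemma kerι_comp (f : A ⟶ B) : kerι f ≫ f = 0 :=
  lin_injective (LinearMap.ext fun x => x.2)

/-- A strict injective morphism whose range is the kernel of `g` is a kernel of `g`. -/
noncomputable def isLimitOfInjective (f : A ⟶ B) (g : B ⟶ C) (w : f ≫ g = 0)
    (hf : Function.Injective (lin f)) (hex : ∀ y, lin g y = 0 → ∃ x, lin f x = y) :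
    IsLimit (KernelFork.ofι f w) := by
  refine KernelFork.IsLimit.ofι f w (fun {X} k hk => ?_) ?_ ?_
  · have hk' : ∀ x, ∃ y, lin f y = lin k x := fun x =>
      hex _ (LinearMap.congr_fun (congrArg lin hk) x)
    let l : X.carrier →ₗ[ℝ] A.carrier :=
      { toFun := fun x => (hk' x).choose
        map_add' := fun x y => hf ((hk' (x + y)).choose_spec.trans (by
          rw [map_add, map_add (lin f), (hk' x).choose_spec, (hk' y).choose_spec]))
        map_smul' := fun c x => hf ((hk' (c • x)).choose_spec.trans (by
          rw [RingHom.id_apply, map_smul, map_smul (lin f), (hk' x).choose_spec])) }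
    have hl : lin f ∘ₗ l = lin k := LinearMap.ext fun x => (hk' x).choose_spec
    refine ⟨l, fun n x hx => ?_, fun p x hx => ?_⟩
    · have h1 : lin f (l x) = lin k x := LinearMap.congr_fun hl x
      obtain ⟨a, ha, e⟩ := Hom.strict_W f (n := n) (x := l x) (by rw [h1]; exact k.map_W n x hx)
      rwa [← hf e]
    · have h1 : (lin f).baseChange ℂ (l.baseChange ℂ x) = (lin k).baseChange ℂ x := by
        rw [← LinearMap.comp_apply, ← LinearMap.baseChange_comp, hl]
      obtain ⟨a, ha, e⟩ := Hom.strict_F f (p := p) (x := l.baseChange ℂ x)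
        (by rw [h1]; exact k.map_F p x hx)
      rwa [← baseChange_injective hf e]
  · intro X k hk
    exact lin_injective (LinearMap.ext fun x =>
      (hex _ (LinearMap.congr_fun (congrArg lin hk) x)).choose_spec)
  · intro X k hk m hm
    refine lin_injective (LinearMap.ext fun x => hf ?_)
    exact (LinearMap.congr_fun (congrArg lin hm) x).trans
      (hex _ (LinearMap.congr_fun (congrArg lin hk) x)).choose_spec.symm

instance : HasKernels RealMHS.{u} where
  has_limit f := HasLimit.mk ⟨_, isLimitOfInjective (kerι f) f (kerι_comp f)
    (Submodule.subtype_injective _) (fun y hy => ⟨⟨y, hy⟩, rfl⟩)⟩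

/-- The cokernel of a morphism, with the quotient filtrations. -/
noncomputable def cokerObj (f : A ⟶ B) : RealMHS.{u} :=
  ofOppElem (B.carrier ⧸ LinearMap.range (lin f))
    (fun n => (B.W n).map (Submodule.mkQ _))
    (fun n => (B.F n).map ((Submodule.mkQ (LinearMap.range (lin f))).baseChange ℂ))
    (fun _ _ e => Submodule.map_mono (B.W_mono e))
    (B.W_bot.imp fun n e => by simp [e])
    (B.W_top.imp fun n e => by simp [e])
    (by
      have := (compat f).map_oppElem A.oppElem B.oppElem
        ((Submodule.mkQ (LinearMap.range (lin f))).baseChange ℂ)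
        (fun z => baseChange_lift (Submodule.mkQ_surjective _ _) (Submodule.mkQ_surjective _ _))
        (fun x => by
          rw [← LinearMap.comp_apply, ← LinearMap.baseChange_comp, LinearMap.range_mkQ_comp]
          simp)
        (fun y hy => by
          refine baseChange_lift ?_ ?_
          · have := congrArg re hy
            rw [re_baseChange, map_zero] at this
            simpa using this
          · have := congrArg im hy
            rw [im_baseChange, map_zero] at this
            simpa using this)
      simpa only [WC, conjF, baseChange_map, conj_map] using this)

/-- The projection to the cokernel. -/
noncomputable def cokerπ (f : A ⟶ B) : B ⟶ cokerObj f :=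
  ⟨Submodule.mkQ (LinearMap.range (lin f)), fun _ x h => ⟨x, h, rfl⟩, fun _ x h => ⟨x, h, rfl⟩⟩

lemma lin_cokerπ_eq_zero (f : A ⟶ B) (y : B.carrier) :
    lin (cokerπ f) y = 0 ↔ ∃ x, lin f x = y :=
  (Submodule.Quotient.mk_eq_zero _).trans LinearMap.mem_range

lemma comp_cokerπ (f : A ⟶ B) : f ≫ cokerπ f = 0 :=
  lin_injective (LinearMap.ext fun x => (lin_cokerπ_eq_zero f _).2 ⟨x, rfl⟩)

/-- A strict surjective morphism whose kernel is the range of `f` is a cokernel of `f`. -/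
noncomputable def isColimitOfSurjective (f : A ⟶ B) (g : B ⟶ C) (w : f ≫ g = 0)
    (hg : Function.Surjective (lin g)) (hex : ∀ y, lin g y = 0 → ∃ x, lin f x = y) :
    IsColimit (CokernelCofork.ofπ g w) := by
  have hk' : ∀ {X : RealMHS.{u}} (k : B ⟶ X), f ≫ k = 0 →
      ∀ x y, lin g x = lin g y → lin k x = lin k y := fun k hk x y e => by
    obtain ⟨z, hz⟩ := hex (x - y) (by rw [map_sub, e, sub_self])
    have : lin k (x - y) = 0 := by
      rw [← hz]; exact LinearMap.congr_fun (congrArg lin hk) z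
    rwa [map_sub, sub_eq_zero] at this
  refine CokernelCofork.IsColimit.ofπ g w (fun {X} k hk => ?_) ?_ ?_
  · let l : C.carrier →ₗ[ℝ] X.carrier :=
      { toFun := fun z => lin k (hg z).choose
        map_add' := fun x y => by
          rw [← map_add]
          refine hk' k hk _ _ ?_
          rw [map_add, (hg (x + y)).choose_spec, (hg x).choose_spec, (hg y).choose_spec]
        map_smul' := fun c x => by
          rw [← map_smul]
          refine hk' k hk _ _ ?_
          rw [RingHom.id_apply, map_smul, (hg (c • x)).choose_spec, (hg x).choose_spec] }
    have hl : l ∘ₗ lin g = lin k := LinearMap.ext fun x =>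
      hk' k hk _ _ (hg (lin g x)).choose_spec
    refine ⟨l, fun n z hz => ?_, fun p z hz => ?_⟩
    · obtain ⟨x, rfl⟩ := hg z
      obtain ⟨a, ha, e⟩ := Hom.strict_W g hz
      rw [← e, ← LinearMap.comp_apply, hl]
      exact k.map_W n a ha
    · obtain ⟨x, rfl⟩ := baseChange_lift (f := lin g) (z := z) (hg _) (hg _)
      obtain ⟨a, ha, e⟩ := Hom.strict_F g hz
      rw [← e, ← LinearMap.comp_apply, ← LinearMap.baseChange_comp, hl]
      exact k.map_F p a ha
  · intro X k hk
    exact lin_injective (LinearMap.ext fun x => hk' k hk _ _ (hg (lin g x)).choose_spec)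
  · intro X k hk m hm
    refine lin_injective (LinearMap.ext fun z => ?_)
    conv_lhs => rw [← (hg z).choose_spec]
    exact LinearMap.congr_fun (congrArg lin hm) (hg z).choose

instance : HasCokernels RealMHS.{u} where
  has_colimit f := HasColimit.mk ⟨_, isColimitOfSurjective f (cokerπ f) (comp_cokerπ f)
    (Submodule.mkQ_surjective _) (fun y hy => (lin_cokerπ_eq_zero f y).1 hy)⟩

lemma injective_of_mono (f : A ⟶ B) [Mono f] : Function.Injective (lin f) := by
  have h : kerι f = 0 := by
    rw [← cancel_mono f, kerι_comp, zero_comp]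
  rw [injective_iff_map_eq_zero]
  intro x hx
  exact LinearMap.congr_fun (congrArg lin h) ⟨x, hx⟩

lemma surjective_of_epi (f : A ⟶ B) [Epi f] : Function.Surjective (lin f) := by
  have h : cokerπ f = 0 := by
    rw [← cancel_epi f, comp_cokerπ, comp_zero]
  intro y
  exact (lin_cokerπ_eq_zero f y).1 (LinearMap.congr_fun (congrArg lin h) y)

instance : HasFiniteProducts RealMHS.{u} := hasFiniteProducts_of_has_binary_and_terminal

/-- Real mixed Hodge structures form an abelian category. -/
noncomputable instance : Abelian RealMHS.{u} where
  normalMonoOfMono f _ := ⟨⟨_, cokerπ f, comp_cokerπ f,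
    isLimitOfInjective f (cokerπ f) (comp_cokerπ f) (injective_of_mono f)
      (fun y hy => (lin_cokerπ_eq_zero f y).1 hy)⟩⟩
  normalEpiOfEpi f _ := ⟨⟨_, kerι f, kerι_comp f,
    isColimitOfSurjective (kerι f) f (kerι_comp f) (surjective_of_epi f)
      (fun y hy => ⟨⟨y, hy⟩, rfl⟩)⟩⟩

instance : HasExt.{u + 1} RealMHS.{u} := HasExt.standard RealMHS.{u}

end RealMHS

/-! The vanishing amounts to right exactness of `Ext¹(B, -)`, and this holds because an extension of
`B` by `M` can be encoded by a single complex linear map `φ` from `B_ℂ` to `M_ℂ` preserving weights,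
a kind of datum that lifts along epimorphisms by strictness.

The homological half is valid in any abelian category and uses neither projectives nor injectives. A
class of positive degree dies on pullback along some epimorphism (`exists_epi_comp_eq_zero`), so a
class of degree at least two is a product `[E] · [T] · y` of two extension classes and a remainder,
where `E` is an extension of `X` by `K` and `T` is an extension of `K` by `L` with middle term `M`.
If `E` is the pushout of an extension of `X` by `M` along `M ⟶ K`, then `[E]` factors through this
map, whose product with `[T]` is zero (`subsingleton_of_lift_extension`).

The Hodge-theoretic half produces that extension. Let `e : P ⟶ B` be the epimorphism of the given
extension. Strictness yields a real section `s` of `e` preserving `W`, and a complex section `t`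
preserving both `W` and `F`; in general no single section does both jobs. The difference `t - s`
measures this failure: it has values in `ker e` and preserves `W`. Since `M` surjects onto `ker e`,
strictness for `W` lifts the difference to a map `φ` into `M_ℂ` preserving `W` (`exists_shear_map`).
Conversely, every `φ` preserving `W` defines a mixed Hodge structure on `M × B`, by shearing the
Hodge filtration of the direct sum (`shearObj`): on the graded pieces for the weight, an extension
of opposed filtrations is again opposed (`prod_shear`). The map `(x, b) ↦ g x + s b`, with `g : M ⟶
P`, then exhibits the sheared sum as the required lift of the extension. -/

namespace CategoryTheory.Abelian.Ext

-- Ext in degrees greater than one and right exactness of `Ext¹`.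

universe w v u'

variable {C : Type u'} [Category.{v} C] [Abelian C]

section

open HomologicalComplex

/-- The top degree component of a resolution of `X` by a complex in degrees `≤ i` gives an
epimorphism `P ⟶ X` which factors through the resolution. -/
lemma exists_epi_comp_eq_single_map {X : C} {K : CochainComplex C ℤ} {i : ℤ}
    (π : K ⟶ (single C (ComplexShape.up ℤ) i).obj X) [K.IsStrictlyLE i] [QuasiIsoAt π i] :
    ∃ (P : C) (e : P ⟶ X) (_ : Epi e) (σ : (single C (ComplexShape.up ℤ) i).obj P ⟶ K),
      σ ≫ π = (single C (ComplexShape.up ℤ) i).map e := by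
  -- As `K` vanishes in degree `i + 1`, all of `K.X i` consists of cycles. Hence `α` is the
  -- projection onto `H^i(K)` followed by an isomorphism with `X`, and the identity of `K.X i` is a
  -- map of complexes from the single complex to `K`.
  let c := K.iCyclesIso i (i + 1) (by simp)
    ((K.isZero_of_isStrictlyLE i (i + 1) (by simp)).eq_of_tgt _ _)
  let α : K.X i ⟶ X :=
    c.inv ≫ K.homologyπ i ≫ homologyMap π i ≫ (singleObjHomologySelfIso _ _ _).hom
  have hπ : π.f i = α ≫ (singleObjXSelf (ComplexShape.up ℤ) i X).inv := by
    rw [← cancel_epi c.hom]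
    simp only [α, c, Category.assoc, homologyπ_naturality_assoc]
    rw [Iso.hom_inv_id_assoc, homologyπ_singleObjHomologySelfIso_hom_assoc,
      ← singleObjCyclesSelfIso_inv_iCycles, Iso.hom_inv_id_assoc, cyclesMap_i]
    rfl
  refine ⟨K.X i, α, ?_, mkHomFromSingle (𝟙 _) ?_, ?_⟩
  · dsimp only [α]
    infer_instance
  · rintro _ rfl
    exact (K.isZero_of_isStrictlyLE i (i + 1) (by simp)).eq_of_tgt _ _
  · apply HomologicalComplex.from_single_hom_ext
    rw [comp_f, mkHomFromSingle_f, hπ, single_map_f_self]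
    simp

end

open _root_.DerivedCategory in
/-- Every class of positive degree vanishes after pulling back along a suitable epimorphism. -/
lemma exists_epi_comp_eq_zero [HasExt.{w} C] {X Y : C} {n : ℕ} (x : Ext.{w} X Y (n + 1)) :
    ∃ (P : C) (e : P ⟶ X) (_ : Epi e), (mk₀ e).comp x (zero_add _) = 0 := by
  let := HasDerivedCategory.standard C
  -- The shift of `Y` by `n + 1` is replaced by the complex equal to `Y` in degree `-(n + 1)`. The
  -- class becomes a roof `X ← K → Y[n + 1]` whose left leg is a quasi-isomorphism and whose apex
  -- lives in degrees `≤ 0`.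
  let s := ((singleFunctors C).shiftIso (n + 1) (-(n + 1)) 0 (by lia)).app Y
  let φ : Q.obj ((CochainComplex.singleFunctor C 0).obj X) ⟶
    Q.obj ((CochainComplex.singleFunctor C (-(n + 1))).obj Y) := x.hom ≫ s.hom
  obtain ⟨K, _, π, h, g, hφ⟩ := right_fac_of_isStrictlyLE φ 0
  rw [isIso_Q_map_iff_quasiIso] at h
  have : QuasiIsoAt (L := (HomologicalComplex.single C (ComplexShape.up ℤ) 0).obj X) π 0 :=
    h.quasiIsoAt 0
  obtain ⟨P, e, he, σ, hσ⟩ : ∃ (P : C) (e : P ⟶ X) (_ : Epi e)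
      (σ : (CochainComplex.singleFunctor C 0).obj P ⟶ K),
      σ ≫ π = (CochainComplex.singleFunctor C 0).map e :=
    exists_epi_comp_eq_single_map (i := 0) π
  refine ⟨P, e, he, ?_⟩
  -- The source is concentrated in degree `0` and the target in degree `-(n + 1) ≠ 0`. This is where
  -- positivity of the degree enters.
  have hσg : σ ≫ g = 0 := by
    apply HomologicalComplex.from_single_hom_ext
    exact (((CochainComplex.singleFunctor C (-(n + 1))).obj Y).isZero_of_isStrictlyLE
      (-(n + 1)) 0 (by lia)).eq_of_tgt _ _
  have key : Q.map ((CochainComplex.singleFunctor C 0).map e) ≫ φ = 0 := by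
    rw [hφ, ← hσ, Q.map_comp, Category.assoc, IsIso.hom_inv_id_assoc, ← Q.map_comp, hσg,
      Q.map_zero]
  ext
  rw [comp_hom, mk₀_hom, ShiftedHom.mk₀_comp, zero_hom, ← cancel_mono s.hom, Limits.zero_comp,
    Category.assoc]
  exact key

/-- Every class of positive degree is the product of the class of an extension and of a class of
degree one less. -/
lemma exists_extClass_comp_eq [HasExt.{w} C] {X Y : C} {m k : ℕ} (x : Ext.{w} X Y k)
    (h : 1 + m = k) :
    ∃ (K P : C) (i : K ⟶ P) (e : P ⟶ X) (z : i ≫ e = 0)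
      (hS : (ShortComplex.mk i e z).ShortExact) (y : Ext.{w} K Y m),
      hS.extClass.comp y h = x := by
  obtain rfl : m + 1 = k := by lia
  obtain ⟨P, e, _, he⟩ := exists_epi_comp_eq_zero x
  have hS : (ShortComplex.mk (kernel.ι e) e (kernel.condition e)).ShortExact :=
    { exact := ShortComplex.exact_of_f_is_kernel _ (kernelIsKernel e) }
  -- Since `x` dies on `P`, the long exact sequence makes it the image of a class on `kernel e`
  -- under the connecting map.
  obtain ⟨y, hy⟩ := contravariant_sequence_exact₃ hS Y x he h
  exact ⟨_, _, _, _, _, hS, y, hy⟩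

/-- `Ext` vanishes in degrees `> 1` if `Ext¹ (X, -)` is right exact, i.e. if every extension of
`X` by a quotient of `M` is the pushout of an extension of `X` by `M`. -/
lemma subsingleton_of_lift_extension [HasExt.{w} C] {X : C}
    (H : ∀ {M K P : C} (f : M ⟶ K) (_ : Epi f) (i : K ⟶ P) (e : P ⟶ X) (z : i ≫ e = 0)
      (_ : (ShortComplex.mk i e z).ShortExact),
      ∃ (N : C) (i' : M ⟶ N) (e' : N ⟶ X) (z' : i' ≫ e' = 0)
        (_ : (ShortComplex.mk i' e' z').ShortExact) (q : N ⟶ P), i' ≫ q = f ≫ i ∧ q ≫ e = e')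
    (Y : C) {n : ℕ} (hn : 1 < n) : Subsingleton (Ext.{w} X Y n) := by
  obtain ⟨n, rfl⟩ : ∃ m, n = 1 + (1 + m) := ⟨n - 2, by lia⟩
  refine subsingleton_of_forall_eq 0 fun x => ?_
  obtain ⟨K, P, i, e, z, hS, y, rfl⟩ := exists_extClass_comp_eq x rfl
  obtain ⟨L, M, j, f, t, hT, y, rfl⟩ := exists_extClass_comp_eq y rfl
  -- The coefficient map `f` is the epimorphism of the second extension, so that its product with
  -- the class of that extension vanishes.
  obtain ⟨N, i', e', z', hS', q, hq, hq'⟩ := H f hT.epi_g i e z hS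
  have hnat := ShortComplex.ShortExact.extClass_naturality hS' hS
    { τ₁ := f, τ₂ := q, τ₃ := 𝟙 X, comm₁₂ := hq.symm, comm₂₃ := by simpa using hq' }
  rw [mk₀_id_comp] at hnat
  rw [← hnat, comp_assoc _ _ _ (add_zero 1) (zero_add (1 + n)) (by lia),
    hT.comp_extClass_assoc, comp_zero]

end CategoryTheory.Abelian.Ext

namespace MHS

/-! Lifting linear maps compatibly with filtrations. -/

section Lifting

variable {k : Type*} [Field k] {V X Z : Type*} [AddCommGroup V] [Module k V]
  [AddCommGroup X] [Module k X] [AddCommGroup Z] [Module k Z]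

/-- Over a field the surjection from `Q'` onto `r(Q')` splits, which turns pointwise lifts into a
linear one on `Q`. Its extension to all of `V` is arbitrary. -/
lemma exists_lift_on (φ : V →ₗ[k] Z) (r : X →ₗ[k] Z) (Q : Submodule k V) (Q' : Submodule k X)
    (h : ∀ x ∈ Q, ∃ y ∈ Q', r y = φ x) :
    ∃ l : V →ₗ[k] X, ∀ x ∈ Q, l x ∈ Q' ∧ r (l x) = φ x := by
  obtain ⟨s, hs⟩ := (r ∘ₗ Q'.subtype).rangeRestrict.exists_rightInverse_of_surjective
    (LinearMap.range_rangeRestrict _)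
  have hφ : ∀ x : Q, (φ ∘ₗ Q.subtype) x ∈ LinearMap.range (r ∘ₗ Q'.subtype) := fun x => by
    obtain ⟨y, hy, e⟩ := h x x.2
    exact ⟨⟨y, hy⟩, e⟩
  obtain ⟨l, hl⟩ := (Q'.subtype ∘ₗ s ∘ₗ (φ ∘ₗ Q.subtype).codRestrict _ hφ).exists_extend
  refine ⟨l, fun x hx => ?_⟩
  have e : l x = s ((φ ∘ₗ Q.subtype).codRestrict _ hφ ⟨x, hx⟩) :=
    LinearMap.congr_fun hl ⟨x, hx⟩
  rw [e]
  exact ⟨Submodule.coe_mem _, congrArg Subtype.val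
    (LinearMap.congr_fun hs ((φ ∘ₗ Q.subtype).codRestrict _ hφ ⟨x, hx⟩))⟩

/-- On `T`, the map `φ` lifts along `r` compatibly with the families of subspaces `S`, `S'`. -/
def LiftsOn {ι : Type*} (φ : V →ₗ[k] Z) (r : X →ₗ[k] Z) (S : ι → Submodule k V)
    (S' : ι → Submodule k X) (T : Submodule k V) : Prop :=
  ∃ l : V →ₗ[k] X, ∀ x ∈ T, r (l x) = φ x ∧ ∀ i, x ∈ S i → l x ∈ S' i

/-- The old lift on `T` is glued to a new lift on a complement of `T` in `T ⊔ Q` chosen inside `Q`.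
The alternative in `hS` makes the gluing compatible with each `S i`: either `S i` contains `Q`, so
both components of a vector of `S i` stay in `S i`, or `S i` meets `T ⊔ Q` only inside `T`, where
the new lift plays no role. -/
lemma LiftsOn.sup {ι : Type*} {φ : V →ₗ[k] Z} {r : X →ₗ[k] Z} {S : ι → Submodule k V}
    {S' : ι → Submodule k X} {T : Submodule k V} (hT : LiftsOn φ r S S' T)
    {Q : Submodule k V} {Q' : Submodule k X} (hQ : ∀ x ∈ Q, ∃ y ∈ Q', r y = φ x)
    (hS : ∀ i, (Q ≤ S i ∧ Q' ≤ S' i) ∨ (T ⊔ Q) ⊓ S i ≤ T) :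
    LiftsOn φ r S S' (T ⊔ Q) := by
  obtain ⟨σ, hσ⟩ := hT
  obtain ⟨l, hl⟩ := exists_lift_on φ r Q Q' hQ
  -- On `T ⊔ Q`, the map `π` built from this section projects onto a complement of `T` contained in
  -- `Q`.
  obtain ⟨s, hs⟩ := exists_lift_on LinearMap.id T.mkQ (Q.map T.mkQ) Q
    (fun _ ⟨y, hy, e⟩ => ⟨y, hy, e⟩)
  let π : V →ₗ[k] V := s ∘ₗ T.mkQ
  have hπT : ∀ x ∈ T, π x = 0 := fun x hx => by
    have : T.mkQ x = 0 := (Submodule.Quotient.mk_eq_zero T).2 hx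
    rw [LinearMap.comp_apply, this, map_zero]
  have hπ : ∀ x ∈ T ⊔ Q, π x ∈ Q ∧ x - π x ∈ T := fun x hx => by
    obtain ⟨t, ht, q, hq, rfl⟩ := Submodule.mem_sup.1 hx
    obtain ⟨h1, h2⟩ := hs (T.mkQ q) ⟨q, hq, rfl⟩
    rw [map_add, hπT t ht, zero_add]
    refine ⟨h1, ?_⟩
    rw [add_sub_assoc]
    exact add_mem ht ((Submodule.Quotient.eq T).1 h2.symm)
  refine ⟨σ ∘ₗ (LinearMap.id - π) + l ∘ₗ π, fun x hx => ?_⟩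
  obtain ⟨h1, h2⟩ := hπ x hx
  change r (σ (x - π x) + l (π x)) = φ x ∧ ∀ i, x ∈ S i → σ (x - π x) + l (π x) ∈ S' i
  refine ⟨by rw [map_add, (hσ _ h2).1, (hl _ h1).2, ← map_add, sub_add_cancel], fun i hi => ?_⟩
  rcases hS i with ⟨h, h'⟩ | h
  · exact add_mem ((hσ _ h2).2 i (sub_mem hi (h h1))) (h' (hl _ h1).1)
  · have hxT := h ⟨hx, hi⟩
    rw [hπT x hxT, map_zero, add_zero, sub_zero]
    exact (hσ x hxT).2 i hi

/-- A linear map lifts compatibly with an increasing and a decreasing finite filtration as soon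
as it lifts pointwise on the intersections of their steps. -/
lemma exists_lift_bifiltered (φ : V →ₗ[k] Z) (r : X →ₗ[k] Z)
    {W F : ℤ → Submodule k V} {W' F' : ℤ → Submodule k X}
    (W_mono : Monotone W) (W_bot : ∃ n, W n = ⊥) (W_top : ∃ n, W n = ⊤)
    (F_anti : Antitone F) (F_bot : ∃ n, F n = ⊥) (F_top : ∃ n, F n = ⊤)
    (W'_mono : Monotone W') (F'_anti : Antitone F')
    (h : ∀ m p, ∀ x ∈ W m, x ∈ F p → ∃ y ∈ W' m, y ∈ F' p ∧ r y = φ x) :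
    ∃ l : V →ₗ[k] X, r ∘ₗ l = φ ∧ (∀ m, ∀ x ∈ W m, l x ∈ W' m) ∧
      ∀ p, ∀ x ∈ F p, l x ∈ F' p := by
  obtain ⟨m₀, hm₀⟩ := W_bot
  obtain ⟨m₁, hm₁⟩ := W_top
  obtain ⟨p₀, hp₀⟩ := F_bot
  obtain ⟨p₁, hp₁⟩ := F_top
  have step : ∀ m, LiftsOn φ r (Sum.elim W F) (Sum.elim W' F') (W (m - 1)) →
      LiftsOn φ r (Sum.elim W F) (Sum.elim W' F') (W m) := by
    intro m hm
    have hW : W (m - 1) ≤ W m := W_mono (by lia)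
    -- Between `W (m - 1)` and `W m`, the lift is extended along decreasing steps of `F`, from `F p₀
    -- = ⊥` down to a step equal to `⊤`.
    have main : ∀ j : ℕ, LiftsOn φ r (Sum.elim W F) (Sum.elim W' F')
        (W (m - 1) ⊔ (W m ⊓ F (p₀ - j))) := by
      intro j
      induction j with
      | zero => simpa [hp₀] using hm
      | succ j ih =>
        have hle : F (p₀ - j) ≤ F (p₀ - (j + 1 : ℕ)) := F_anti (by push_cast; lia)
        have e : W (m - 1) ⊔ (W m ⊓ F (p₀ - (j + 1 : ℕ))) =
            (W (m - 1) ⊔ (W m ⊓ F (p₀ - j))) ⊔ (W m ⊓ F (p₀ - (j + 1 : ℕ))) := by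
          rw [sup_assoc, sup_eq_right.2 (inf_le_inf_left _ hle)]
        rw [e]
        refine ih.sup (Q' := W' m ⊓ F' (p₀ - (j + 1 : ℕ))) (fun x hx => ?_) ?_
        · obtain ⟨y, hy, hy', e⟩ := h m _ x hx.1 hx.2
          exact ⟨y, ⟨hy, hy'⟩, e⟩
        -- A step of either filtration at or beyond the current index contains `W m ⊓ F (p₀ - (j +
        -- 1))`. An earlier step of `W` lies in `W (m - 1)`. An earlier step of `F` lies in `F (p₀ -
        -- j)`, and everything in sight lies in `W m`, so the intersection is already covered.
        rintro (m' | p')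
        · rcases le_or_gt m m' with hmm | hmm
          · exact Or.inl ⟨inf_le_left.trans (W_mono hmm), inf_le_left.trans (W'_mono hmm)⟩
          · exact Or.inr (inf_le_right.trans ((W_mono (by lia)).trans le_sup_left))
        · rcases le_or_gt p' (p₀ - (j + 1 : ℕ)) with hpp | hpp
          · exact Or.inl ⟨inf_le_right.trans (F_anti hpp), inf_le_right.trans (F'_anti hpp)⟩
          · refine Or.inr (le_trans (inf_le_inf ?_ (F_anti ?_)) le_sup_right)
            · exact sup_le (sup_le hW inf_le_left) inf_le_left
            · push_cast at hpp; lia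
    have hp : F (p₀ - (p₀ - p₁).toNat) = ⊤ := top_le_iff.1 (hp₁ ▸ F_anti (by lia))
    have := main (p₀ - p₁).toNat
    rwa [hp, inf_top_eq, sup_eq_right.2 hW] at this
  have all : ∀ j : ℕ, LiftsOn φ r (Sum.elim W F) (Sum.elim W' F') (W (m₀ + j)) := by
    intro j
    induction j with
    | zero =>
      refine ⟨0, fun x hx => ?_⟩
      have : x = 0 := by simpa [hm₀] using hx
      simp [this]
    | succ j ih => exact step _ (by convert ih using 2; push_cast; lia)
  obtain ⟨l, hl⟩ := all (m₁ - m₀).toNat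
  have hm : W (m₀ + (m₁ - m₀).toNat) = ⊤ := top_le_iff.1 (hm₁ ▸ W_mono (by lia))
  rw [hm] at hl
  exact ⟨l, LinearMap.ext fun x => (hl x trivial).1,
    fun m x hx => (hl x trivial).2 (Sum.inl m) hx, fun p x hx => (hl x trivial).2 (Sum.inr p) hx⟩

/-- A linear map lifts compatibly with a finite filtration as soon as it lifts pointwise. -/
lemma exists_lift_filtered (φ : V →ₗ[k] Z) (r : X →ₗ[k] Z)
    {W : ℤ → Submodule k V} {W' : ℤ → Submodule k X}
    (W_mono : Monotone W) (W_bot : ∃ n, W n = ⊥) (W_top : ∃ n, W n = ⊤)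
    (W'_mono : Monotone W') (h : ∀ m, ∀ x ∈ W m, ∃ y ∈ W' m, r y = φ x) :
    ∃ l : V →ₗ[k] X, r ∘ₗ l = φ ∧ ∀ m, ∀ x ∈ W m, l x ∈ W' m := by
  -- The second filtration is trivial on the source and constantly `⊤` on the target, so it imposes
  -- no condition.
  obtain ⟨l, hl, hW, -⟩ := exists_lift_bifiltered φ r (F := fun p => if p ≤ 0 then ⊤ else ⊥)
    (F' := fun _ => ⊤) W_mono W_bot W_top
    (fun a b e => by
      by_cases hb : b ≤ 0
      · simp [hb, e.trans hb]
      · simp [hb])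
    ⟨1, by simp⟩ ⟨0, by simp⟩ W'_mono antitone_const (fun m p x hx _ => by
      obtain ⟨y, hy, e⟩ := h m x hx
      exact ⟨y, hy, trivial, e⟩)
  exact ⟨l, hl, hW⟩

end Lifting

/-! Twisting a direct sum of opposed filtrations. -/

/-- In a direct sum, `F` and `G` may be sheared by maps of weight `0`: on `Gr^W` an extension of
opposed filtrations is opposed. -/
lemma OppElem.prod_shear {V V' V'' : Type*} [AddCommGroup V] [Module ℂ V] [AddCommGroup V']
    [Module ℂ V'] [AddCommGroup V''] [Module ℂ V'']
    {W₁ F₁ G₁ : ℤ → Submodule ℂ V} {W₂ F₂ G₂ : ℤ → Submodule ℂ V'}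
    (h₁ : OppElem W₁ F₁ G₁) (h₂ : OppElem W₂ F₂ G₂)
    (r₁ : V'' →ₗ[ℂ] V) (r₂ : V'' →ₗ[ℂ] V') (hinj : ∀ z, r₁ z = 0 → r₂ z = 0 → z = 0)
    (hsurj : ∀ x y, ∃ z, r₁ z = x ∧ r₂ z = y) (φ ψ : V' →ₗ[ℂ] V)
    (hφ : ∀ n, ∀ x ∈ W₂ n, φ x ∈ W₁ n) (hψ : ∀ n, ∀ x ∈ W₂ n, ψ x ∈ W₁ n) :
    OppElem (fun n => (W₁ n).comap r₁ ⊓ (W₂ n).comap r₂)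
      (fun n => (F₁ n).comap (r₁ - φ ∘ₗ r₂) ⊓ (F₂ n).comap r₂)
      (fun n => (G₁ n).comap (r₁ - ψ ∘ₗ r₂) ⊓ (G₂ n).comap r₂) := by
  -- In the coordinates `(r₁ - θ ∘ r₂, r₂)` a filtration sheared by `θ` is an ordinary direct sum,
  -- hence finite and monotone. Opposedness needs a separate argument because `F` and `G` use
  -- different shears.
  have aux : ∀ θ : V' →ₗ[ℂ] V, OppElem
      (fun n => (W₁ n).comap (r₁ - θ ∘ₗ r₂) ⊓ (W₂ n).comap r₂)
      (fun n => (F₁ n).comap (r₁ - θ ∘ₗ r₂) ⊓ (F₂ n).comap r₂)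
      (fun n => (G₁ n).comap (r₁ - θ ∘ₗ r₂) ⊓ (G₂ n).comap r₂) := fun θ => by
    refine h₁.prod h₂ (r₁ - θ ∘ₗ r₂) r₂ (fun z h h' => hinj z ?_ h') (fun x y => ?_)
    · simpa [h'] using h
    · obtain ⟨z, hz, hz'⟩ := hsurj (x + θ y) y
      exact ⟨z, by simp [hz, hz'], hz'⟩
  have hprod := h₁.prod h₂ r₁ r₂ hinj hsurj
  have hF := aux φ
  have hG := aux ψ
  refine ⟨hprod.W_mono, hprod.W_bot, hprod.W_top, hF.F_anti, hF.F_bot, hF.F_top,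
    hG.G_anti, hG.G_bot, hG.G_top, ?_, ?_⟩
  · rintro n p q e z ⟨hz₁, hz₂⟩
    obtain ⟨a₂, ha₂, ha₂', b₂, hb₂, hb₂', hw₂⟩ := h₂.span n p q e _ hz₂
    -- The second coordinate is decomposed first. The shears of its two parts, which stay in `W₁ n`,
    -- are removed from the first coordinate before decomposing it.
    obtain ⟨a₁, ha₁, ha₁', b₁, hb₁, hb₁', hw₁⟩ := h₁.span n p q e (r₁ z - φ a₂ - ψ b₂)
      (sub_mem (sub_mem hz₁ (hφ _ _ ha₂')) (hψ _ _ hb₂'))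
    obtain ⟨a, ea₁, ea₂⟩ := hsurj (a₁ + φ a₂) a₂
    obtain ⟨b, eb₁, eb₂⟩ := hsurj (b₁ + ψ b₂) b₂
    refine ⟨a, ⟨?_, ?_⟩, ⟨?_, ?_⟩, b, ⟨?_, ?_⟩, ⟨?_, ?_⟩, ⟨?_, ?_⟩⟩ <;>
      simp only [Submodule.mem_comap, SetLike.mem_coe, LinearMap.sub_apply, LinearMap.comp_apply,
        map_sub, ea₁, ea₂, eb₁, eb₂, add_sub_cancel_right]
    · exact ha₁
    · exact ha₂
    · exact add_mem ha₁' (hφ _ _ ha₂')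
    · exact ha₂'
    · exact hb₁
    · exact hb₂
    · exact add_mem hb₁' (hψ _ _ hb₂')
    · exact hb₂'
    · convert hw₁ using 1; abel
    · exact hw₂
  · rintro n p q e a ⟨ha₁, ha₂⟩ ⟨ha₁', ha₂'⟩ b ⟨hb₁, hb₂⟩ ⟨hb₁', hb₂'⟩ ⟨hw₁, hw₂⟩
    simp only [Submodule.mem_comap, SetLike.mem_coe, LinearMap.sub_apply, LinearMap.comp_apply,
      map_sub] at *
    have ha : r₂ a ∈ W₂ (n - 1) := h₂.disj n p q e _ ha₂ ha₂' _ hb₂ hb₂' hw₂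
    have hb : r₂ b ∈ W₂ (n - 1) := by simpa using sub_mem ha hw₂
    refine ⟨?_, ha⟩
    -- Once the second coordinates lie in `W₂ (n - 1)`, both shearing terms lie in `W₁ (n - 1)` and
    -- do not affect the comparison in `V`.
    have key := h₁.disj n p q e _ ha₁ (sub_mem ha₁' (hφ _ _ ha₂')) _ hb₁
      (sub_mem hb₁' (hψ _ _ hb₂')) (by
        have : r₁ a - φ (r₂ a) - (r₁ b - ψ (r₂ b)) = r₁ a - r₁ b - φ (r₂ a) + ψ (r₂ b) := by abel
        rw [this]
        exact add_mem (sub_mem hw₁ (hφ _ _ ha)) (hψ _ _ hb))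
    simpa using add_mem key (hφ _ _ ha)

end MHS

/-! ### Extensions of real mixed Hodge structures obtained by shearing a direct sum. -/

namespace RealMHS

open MHS

variable {A B C : RealMHS.{u}}

section Shear

variable (A B : RealMHS.{u})

/-- The first projection, complexified. -/
noncomputable def fstC : ℂ ⊗[ℝ] (A.carrier × B.carrier) →ₗ[ℂ] ℂ ⊗[ℝ] A.carrier :=
  (LinearMap.fst ℝ A.carrier B.carrier).baseChange ℂ

/-- The second projection, complexified. -/
noncomputable def sndC : ℂ ⊗[ℝ] (A.carrier × B.carrier) →ₗ[ℂ] ℂ ⊗[ℝ] B.carrier :=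
  (LinearMap.snd ℝ A.carrier B.carrier).baseChange ℂ

lemma fstC_inl (x : ℂ ⊗[ℝ] A.carrier) :
    fstC A B ((LinearMap.inl ℝ A.carrier B.carrier).baseChange ℂ x) = x := by
  simp [fstC, ← LinearMap.comp_apply, ← LinearMap.baseChange_comp]

lemma sndC_inl (x : ℂ ⊗[ℝ] A.carrier) :
    sndC A B ((LinearMap.inl ℝ A.carrier B.carrier).baseChange ℂ x) = 0 := by
  simp [sndC, ← LinearMap.comp_apply, ← LinearMap.baseChange_comp]

lemma fstC_inr (x : ℂ ⊗[ℝ] B.carrier) :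
    fstC A B ((LinearMap.inr ℝ A.carrier B.carrier).baseChange ℂ x) = 0 := by
  simp [fstC, ← LinearMap.comp_apply, ← LinearMap.baseChange_comp]

lemma sndC_inr (x : ℂ ⊗[ℝ] B.carrier) :
    sndC A B ((LinearMap.inr ℝ A.carrier B.carrier).baseChange ℂ x) = x := by
  simp [sndC, ← LinearMap.comp_apply, ← LinearMap.baseChange_comp]

lemma eq_zero_of_fstC_sndC {z : ℂ ⊗[ℝ] (A.carrier × B.carrier)} (h₁ : fstC A B z = 0)
    (h₂ : sndC A B z = 0) : z = 0 := by
  refine ext_re_im (Prod.ext ?_ ?_) (Prod.ext ?_ ?_)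
  · simpa [fstC, re_baseChange] using congrArg re h₁
  · simpa [sndC, re_baseChange] using congrArg re h₂
  · simpa [fstC, im_baseChange] using congrArg im h₁
  · simpa [sndC, im_baseChange] using congrArg im h₂

variable {A B}

/-- The complex conjugate of a complex linear map between complexifications. -/
noncomputable def conjMap (φ : ℂ ⊗[ℝ] B.carrier →ₗ[ℂ] ℂ ⊗[ℝ] A.carrier) :
    ℂ ⊗[ℝ] B.carrier →ₗ[ℂ] ℂ ⊗[ℝ] A.carrier :=
  (conj A.carrier).comp (φ.comp (conj B.carrier))

lemma conjMap_apply (φ : ℂ ⊗[ℝ] B.carrier →ₗ[ℂ] ℂ ⊗[ℝ] A.carrier) (x : ℂ ⊗[ℝ] B.carrier) :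
    conjMap φ x = conj A.carrier (φ (conj B.carrier x)) := rfl

/-- The weight filtration is defined over `ℝ`, and conjugation only changes the sign of the
imaginary part. Consequently `conjMap φ` preserves weights whenever `φ` does. -/
lemma conj_mem_WC {n : ℤ} {x : ℂ ⊗[ℝ] A.carrier} (hx : x ∈ A.WC n) :
    conj A.carrier x ∈ A.WC n := by
  have key : ∀ z : ℂ ⊗[ℝ] A.carrier, re (conj A.carrier z) = re z ∧
      im (conj A.carrier z) = -im z := fun z => by
    induction z with
    | zero => simp
    | tmul c h => simp
    | add x y hx hy => simp only [map_add, hx, hy, neg_add, and_self]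
  rw [WC, mem_baseChange_iff] at hx ⊢
  rw [(key x).1, (key x).2]
  exact ⟨hx.1, neg_mem hx.2⟩

/-- The Hodge filtration of the direct sum of `A` and `B`, sheared by `φ`. -/
noncomputable def shearF (φ : ℂ ⊗[ℝ] B.carrier →ₗ[ℂ] ℂ ⊗[ℝ] A.carrier) (n : ℤ) :
    Submodule ℂ (ℂ ⊗[ℝ] (A.carrier × B.carrier)) :=
  (A.F n).comap (fstC A B - φ ∘ₗ sndC A B) ⊓ (B.F n).comap (sndC A B)

lemma mem_shearF {φ : ℂ ⊗[ℝ] B.carrier →ₗ[ℂ] ℂ ⊗[ℝ] A.carrier} {n : ℤ}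
    {z : ℂ ⊗[ℝ] (A.carrier × B.carrier)} :
    z ∈ shearF φ n ↔ fstC A B z - φ (sndC A B z) ∈ A.F n ∧ sndC A B z ∈ B.F n := Iff.rfl

lemma inl_mem_shearF (φ : ℂ ⊗[ℝ] B.carrier →ₗ[ℂ] ℂ ⊗[ℝ] A.carrier) {n : ℤ}
    {x : ℂ ⊗[ℝ] A.carrier} (h : x ∈ A.F n) :
    (LinearMap.inl ℝ A.carrier B.carrier).baseChange ℂ x ∈ shearF φ n := by
  rw [mem_shearF, fstC_inl, sndC_inl, map_zero, sub_zero]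
  exact ⟨h, zero_mem _⟩

/-- The two projections are real and so commute with conjugation; only the shear gets conjugated.
This is why `OppElem.prod_shear` allows two different shears. -/
lemma conj_shearF (φ : ℂ ⊗[ℝ] B.carrier →ₗ[ℂ] ℂ ⊗[ℝ] A.carrier) (n : ℤ) :
    (shearF φ n).map (conj (A.carrier × B.carrier)) =
      (A.conjF n).comap (fstC A B - conjMap φ ∘ₗ sndC A B) ⊓ (B.conjF n).comap (sndC A B) := by
  ext z
  rw [mem_map_conj, mem_shearF, Submodule.mem_inf, Submodule.mem_comap, Submodule.mem_comap,
    conjF, conjF, mem_map_conj, mem_map_conj, LinearMap.sub_apply, LinearMap.comp_apply,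
    conjMap_apply, map_sub, conj_conj]
  simp only [fstC, sndC, conj_baseChange]

/-- The extension of `B` by `A` with underlying weight filtration the direct sum, and with
Hodge filtration sheared by `φ`. -/
noncomputable def shearObj (φ : ℂ ⊗[ℝ] B.carrier →ₗ[ℂ] ℂ ⊗[ℝ] A.carrier)
    (hφ : ∀ n, ∀ x ∈ B.WC n, φ x ∈ A.WC n) : RealMHS.{u} :=
  ofOppElem (A.carrier × B.carrier)
    (fun n => (A.W n).comap (LinearMap.fst ℝ _ _) ⊓ (B.W n).comap (LinearMap.snd ℝ _ _))
    (shearF φ)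
    (prodObj A B).W_mono (prodObj A B).W_bot (prodObj A B).W_top (by
      have := A.oppElem.prod_shear B.oppElem (fstC A B) (sndC A B)
        (fun z => eq_zero_of_fstC_sndC A B)
        (fun x y => ⟨(LinearMap.inl ℝ A.carrier B.carrier).baseChange ℂ x +
          (LinearMap.inr ℝ A.carrier B.carrier).baseChange ℂ y,
          by rw [map_add, fstC_inl, fstC_inr, add_zero],
          by rw [map_add, sndC_inl, sndC_inr, zero_add]⟩)
        φ (conjMap φ) hφ (fun n x hx => conj_mem_WC (hφ n _ (conj_mem_WC hx)))
      simp only [← conj_shearF] at this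
      simp only [baseChange_inf, baseChange_comap]
      exact this)

variable (φ : ℂ ⊗[ℝ] B.carrier →ₗ[ℂ] ℂ ⊗[ℝ] A.carrier) (hφ : ∀ n, ∀ x ∈ B.WC n, φ x ∈ A.WC n)

/-- The inclusion of `A` in a sheared direct sum. -/
noncomputable def shearι : A ⟶ shearObj φ hφ :=
  ⟨LinearMap.inl ℝ A.carrier B.carrier, fun n _ h => ⟨h, zero_mem (B.W n)⟩,
    fun _ _ h => inl_mem_shearF φ h⟩

/-- The projection of a sheared direct sum to `B`. -/
noncomputable def shearπ : shearObj φ hφ ⟶ B :=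
  ⟨LinearMap.snd ℝ A.carrier B.carrier, fun _ _ h => h.2, fun _ _ h => h.2⟩

lemma shearι_shearπ : shearι φ hφ ≫ shearπ φ hφ = 0 :=
  lin_injective (LinearMap.ext fun _ => rfl)

end Shear

/-! ### Short exact sequences and the comparison of extensions with sheared sums. -/

lemma mono_of_injective (f : A ⟶ B) (hf : Function.Injective (lin f)) : Mono f :=
  ⟨fun _ _ e => lin_injective (LinearMap.ext fun x =>
    hf (LinearMap.congr_fun (congrArg lin e) x))⟩

lemma epi_of_surjective (f : A ⟶ B) (hf : Function.Surjective (lin f)) : Epi f :=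
  ⟨fun _ _ e => lin_injective (LinearMap.ext fun y => by
    obtain ⟨x, rfl⟩ := hf y
    exact LinearMap.congr_fun (congrArg lin e) x)⟩

lemma shortExact_of_lin (f : A ⟶ B) (g : B ⟶ C) (w : f ≫ g = 0)
    (hf : Function.Injective (lin f)) (hg : Function.Surjective (lin g))
    (hex : ∀ y, lin g y = 0 → ∃ x, lin f x = y) : (ShortComplex.mk f g w).ShortExact where
  exact := ShortComplex.exact_of_f_is_kernel _ (isLimitOfInjective f g w hf hex)
  mono_f := mono_of_injective f hf
  epi_g := epi_of_surjective g hg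

/-- The concrete kernel `kerι g` factors through `f`, because `f` is a categorical kernel of `g`. -/
lemma exists_lin_eq_of_shortExact {f : A ⟶ B} {g : B ⟶ C} {w : f ≫ g = 0}
    (h : (ShortComplex.mk f g w).ShortExact) (y : B.carrier) (hy : lin g y = 0) :
    ∃ x, lin f x = y := by
  have e : h.fIsKernel.lift (KernelFork.ofι (kerι g) (kerι_comp g)) ≫ f = kerι g :=
    h.fIsKernel.fac _ WalkingParallelPair.zero
  exact ⟨_, LinearMap.congr_fun (congrArg lin e) ⟨y, hy⟩⟩

lemma shortExact_shear (φ : ℂ ⊗[ℝ] B.carrier →ₗ[ℂ] ℂ ⊗[ℝ] A.carrier)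
    (hφ : ∀ n, ∀ x ∈ B.WC n, φ x ∈ A.WC n) :
    (ShortComplex.mk (shearι φ hφ) (shearπ φ hφ) (shearι_shearπ φ hφ)).ShortExact :=
  shortExact_of_lin _ _ _ (fun _ _ e => congrArg Prod.fst e) (fun b => ⟨(0, b), rfl⟩)
    (fun y hy => ⟨y.1, Prod.ext rfl (Eq.symm hy)⟩)

/-- If `M ⟶ P ⟶ B ⟶ 0` is exact, then some extension of `B` by `M` maps to `P`, compatibly with
the maps from `M` and to `B`. -/
lemma exists_shear_map {M P : RealMHS.{u}} (g : M ⟶ P) (e : P ⟶ B)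
    (he : Function.Surjective (lin e)) (hex : ∀ y, lin e y = 0 → ∃ x, lin g x = y)
    (w : g ≫ e = 0) :
    ∃ (φ : ℂ ⊗[ℝ] B.carrier →ₗ[ℂ] ℂ ⊗[ℝ] M.carrier) (hφ : ∀ n, ∀ x ∈ B.WC n, φ x ∈ M.WC n)
      (q : shearObj φ hφ ⟶ P), shearι φ hφ ≫ q = g ∧ q ≫ e = shearπ φ hφ := by
  -- `s` is a section of `e` over `ℝ` that respects `W` but in general not `F`.
  obtain ⟨s, hs, hsW⟩ := exists_lift_filtered LinearMap.id (lin e) B.W_mono B.W_bot B.W_top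
    P.W_mono (fun m x hx => by
      obtain ⟨y, rfl⟩ := he x
      exact Hom.strict_W e hx)
  have heC : ∀ z, ∃ y, (lin e).baseChange ℂ y = z := fun z => baseChange_lift (he _) (he _)
  -- `t` is a section over `ℂ` that respects `W` and `F` but in general is not real. The pointwise
  -- lifts come from strictness on the intersections of steps of `F` and `W`.
  obtain ⟨t, ht, htW, htF⟩ := exists_lift_bifiltered (LinearMap.id) ((lin e).baseChange ℂ)
    B.oppElem.W_mono B.oppElem.W_bot B.oppElem.W_top B.F_anti B.F_bot B.F_top
    P.oppElem.W_mono P.F_anti (fun m p x hx hx' => by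
      obtain ⟨y, rfl⟩ := heC x
      obtain ⟨a, ha, ha', e'⟩ := (compat e).strict_FW P.oppElem B.oppElem hx' hx
      exact ⟨a, ha', ha, e'⟩)
  have hsC : (lin e).baseChange ℂ ∘ₗ s.baseChange ℂ = LinearMap.id := by
    rw [← LinearMap.baseChange_comp, hs, LinearMap.baseChange_id]
  have hsWC : ∀ n, ∀ x ∈ B.WC n, s.baseChange ℂ x ∈ P.WC n := fun n x hx => by
    rw [WC, mem_baseChange_iff] at hx ⊢
    rw [re_baseChange, im_baseChange]
    exact ⟨hsW _ _ hx.1, hsW _ _ hx.2⟩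
  -- Two sections differ by a map into the kernel of `e`, which is the image of `g`. Strictness of
  -- `g` for `W` gives preimages of the right weight.
  obtain ⟨φ, hgφ, hφ⟩ := exists_lift_filtered (t - s.baseChange ℂ) ((lin g).baseChange ℂ)
    B.oppElem.W_mono B.oppElem.W_bot B.oppElem.W_top M.oppElem.W_mono (fun m x hx => by
      have h0 : (lin e).baseChange ℂ ((t - s.baseChange ℂ) x) = 0 := by
        have h1 := LinearMap.congr_fun ht x
        have h2 := LinearMap.congr_fun hsC x
        rw [LinearMap.comp_apply] at h1 h2
        rw [LinearMap.sub_apply, map_sub, h1, h2, sub_self]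
      obtain ⟨y, hy⟩ := baseChange_lift (f := lin g) (z := (t - s.baseChange ℂ) x)
        (hex _ (by rw [← re_baseChange, h0, map_zero]))
        (hex _ (by rw [← im_baseChange, h0, map_zero]))
      rw [← hy]
      exact (compat g).strict_W M.oppElem P.oppElem
        (by rw [hy]; exact sub_mem (htW _ _ hx) (hsWC _ _ hx)))
  refine ⟨φ, hφ, ⟨lin g ∘ₗ LinearMap.fst ℝ M.carrier B.carrier +
    s ∘ₗ LinearMap.snd ℝ M.carrier B.carrier, ?_, ?_⟩, ?_, ?_⟩
  · exact fun n x hx => add_mem (g.map_W _ _ hx.1) (hsW _ _ hx.2)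
  · intro p z hz
    obtain ⟨h1, h2⟩ := mem_shearF.1 hz
    have h3 := LinearMap.congr_fun hgφ (sndC M B z)
    rw [LinearMap.comp_apply, LinearMap.sub_apply] at h3
    -- Since `g ∘ φ = t - s`, one has `g x + s b = g (x - φ b) + t b`. For `(x, b)` in the sheared
    -- filtration both terms on the right lie in the Hodge filtration of `P`.
    have h4 : (lin g ∘ₗ LinearMap.fst ℝ M.carrier B.carrier +
        s ∘ₗ LinearMap.snd ℝ M.carrier B.carrier).baseChange ℂ z =
        (lin g).baseChange ℂ (fstC M B z - φ (sndC M B z)) + t (sndC M B z) := by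
      rw [LinearMap.baseChange_add, LinearMap.baseChange_comp, LinearMap.baseChange_comp, map_sub,
        h3]
      change (lin g).baseChange ℂ (fstC M B z) + s.baseChange ℂ (sndC M B z) = _
      abel
    exact h4 ▸ add_mem (g.map_F _ _ h1) (htF _ _ h2)
  · refine lin_injective (LinearMap.ext fun x => ?_)
    change lin g x + s 0 = lin g x
    rw [map_zero, add_zero]
  · refine lin_injective (LinearMap.ext fun x => ?_)
    change lin e (lin g x.1 + s x.2) = x.2
    have h1 : lin e (lin g x.1) = 0 := LinearMap.congr_fun (congrArg lin w) x.1
    have h2 : lin e (s x.2) = x.2 := LinearMap.congr_fun hs x.2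
    rw [map_add, h1, h2, zero_add]

end RealMHS

/-! ### Vanishing of the higher extension groups. -/

theorem mainTheorem5 (A B : RealMHS.{u}) (p : ℕ) (hp : 1 < p) :
    Subsingleton (CategoryTheory.Abelian.Ext.{u + 1} B A p) := by
  refine Abelian.Ext.subsingleton_of_lift_extension (fun {M K P} f hf i e z hS => ?_) A hp
  -- As `f` is surjective, `f ≫ i` has the same image as `i`, namely the kernel of `e`. The sheared
  -- sum of `M` and `B` is then an extension whose pushout along `f` is the given one.
  obtain ⟨φ, hφ, q, h, h'⟩ := RealMHS.exists_shear_map (f ≫ i) e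
    (have := hS.epi_g; RealMHS.surjective_of_epi e) (fun y hy => by
      obtain ⟨x, rfl⟩ := RealMHS.exists_lin_eq_of_shortExact hS y hy
      obtain ⟨m, rfl⟩ := RealMHS.surjective_of_epi f x
      exact ⟨m, rfl⟩)
    (by rw [Category.assoc, z, comp_zero])
  exact ⟨_, _, _, _, RealMHS.shortExact_shear φ hφ, q, h, h'⟩
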